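/- **Setting.** Let $d\ge 1$, $q\ge 2$, $T\ge 2$. There are $N$ items and $K$ key-terms, weights $w_{a,k}\ge 0$ with $\sum_k w_{a,k}=1$ for every item $a$ and $\sum_a w_{a,k}>0$ for every key-term $k$, and an unknown $\theta_*\in\mathbb R^d$ with $\|\theta_*\|_2\le 1$. In each round $t=1,\dots,T$ feature vectors $x_{a,t}\in\mathbb R^d$ with $\|x_{a,t}\|_2\le 1$, revenues $r_{a,t}\in[-1,1]$ and a set $\mathcal A_t$ of at least $q$ available items are revealed (they may be random and depend on the past); the key-term features are $\tilde x_{k,t}=\sum_a w_{a,k}x_{a,t}/\sum_a w_{a,k}$. The candidate assortments are $\mathcal C_t=\{C\subseteq\mathcal A_t:|C|\le q\}$. For a finite set $C$ of objects with features $y_j$ the multinomial-logit probabilities are $p_i(C,\theta)=\frac{e^{y_i^\top\theta}}{1+\sum_{j\in C}e^{y_j^\top\theta}}$ for $i\in C$ and $p_0(C,\theta)=\frac{1}{1+\sum_{j\in C}e^{y_j^\top\theta}}$ (no choice); a user who is offered $C$ chooses, conditionally on the past, $i\in C\cup\{0\}$ with probability $p_i(C,\theta_*)$. Let $\kappa_2>0$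 satisfy $p_i(C,\theta)\,p_0(C,\theta)\ge\kappa_2$ for all $t\le T$, $C\in\mathcal C_t$, $i\in C$ and $\|\theta-\theta_*\|_2\le1$. Let $\mathcal B_t=\{k_1,\dots,k_d\}$ be a barycentric spanner of the key-terms in round $t$ (every $\tilde x_{k,t}$ is a combination of the $\tilde x_{k_i,t}$ with coefficients in $[-1,1]$), and let $\lambda'>0$ satisfy $\lambda_{\min}\big(\frac1d\sum_{i=1}^d\tilde x_{k_i,t}\tilde x_{k_i,t}^\top\big)\ge\lambda'$ for all $t\le T$. **Algorithm (ConMNL).** Let $b\in(0,1)$ and $b(t)=b\,t$. At most one conversation takes place per round, and at least $\lfloor b(t)\rfloor$ of the first $t$ rounds have one, for every $t\le T$. In a conversation $q$ key-terms, each uniformly distributed on $\mathcal B_t$ given the past, form the set $K_t$ offered to the user, who makes a multinomial-logit choice from it; $K_t=\emptyset$ in the other rounds. In rounds $t\le T_0$ the assortment $C_t$ is a uniformly random set of $q$ available items. In round $t>T_0$ put $M_t=\sum_{s<t}\sum_{i\in C_s}x_{i,s}x_{i,s}^\top+\sum_{s\le t}\sum_{k\in K_s}\tilde x_{k,s}\tilde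 x_{k,s}^\top$; let $\theta_t$ be the maximum likelihood estimator, i.e. a solution of $$\sum_{s<t}\sum_{i\in C_s}\big(o_{i,s}-p_i(C_s,\theta)\big)x_{i,s}+\sum_{s\le t}\sum_{k\in K_s}\big(\tilde o_{k,s}-p_k(K_s,\theta)\big)\tilde x_{k,s}=0,$$ where $o_{i,s},\tilde o_{k,s}\in\{0,1\}$ indicate the choices ($\theta_t$ is arbitrary if there is no solution); let $z_{a,t}=x_{a,t}^\top\theta_t+\alpha_t\|x_{a,t}\|_{M_t^{-1}}$ with $$\alpha_t=\frac1{2\kappa_2}\sqrt{2d\log\Big(1+\frac{b(t)+t}{d}\Big)+2\log t},$$ and let $C_t$ maximize $\frac{\sum_{i\in C}r_{i,t}e^{z_{i,t}}}{1+\sum_{i\in C}e^{z_{i,t}}}$ over $C\in\mathcal C_t$ ($C_t\in\mathcal C_t$ is arbitrary if $M_t$ is singular). Put $R_t(C)=\sum_{i\in C}r_{i,t}\,p_i(C,\theta_*)$. **Theorem.** Let $b\in(0,1)$ and $\kappa_2,\lambda',c,\delta_0>0$. There is a constant $A$, depending only on these five numbers, such that for all $d,N,K,q,T$ and all environments as above,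 for all $\delta$ with $\delta_0/T^2\le\delta\le\frac18$, and for every exploration length $$T_0\le c\,\max\Big\{\frac1{\kappa_2^2}\Big(d\log\frac{b(T)+T}{d}+4\log T\Big),\ \frac q{\sigma^2},\ \frac{256}{b\,q\,\lambda'}\log\frac{128\,d}{\delta\,\lambda'^2}\Big\},\qquad \sigma=\tfrac12,$$ the expected regret of ConMNL satisfies $$\mathbb E\Big[\sum_{t=1}^T\Big(\max_{C\in\mathcal C_t}R_t(C)-R_t(C_t)\Big)\Big]\le A\sqrt{d\,T\,q\,\log T}.$$ -/

import Mathlib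

open MeasureTheory

namespace ConMNL

noncomputable section

/-- Multinomial-logit choice probabilities for the offered set `C` with features `x` and
parameter `θ`; `none` is the outside option (nothing is chosen). -/
def mnlProb {d : ℕ} {ι : Type} [DecidableEq ι] (x : ι → EuclideanSpace ℝ (Fin d))
    (C : Finset ι) (θ : EuclideanSpace ℝ (Fin d)) : Option ι → ℝ
  | none => 1 / (1 + ∑ j ∈ C, Real.exp (inner ℝ (x j) θ))
  | some i =>
      if i ∈ C then Real.exp (inner ℝ (x i) θ) / (1 + ∑ j ∈ C, Real.exp (inner ℝ (x j) θ))
      else 0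

/-- Expected revenue of the assortment `C` when the item utilities are `z` and the revenues `r`. -/
def revenue {N : ℕ} (r : Fin N → ℝ) (z : Fin N → ℝ) (C : Finset (Fin N)) : ℝ :=
  (∑ i ∈ C, r i * Real.exp (z i)) / (1 + ∑ i ∈ C, Real.exp (z i))

/-- The outer product `v vᵀ`. -/
def outer {d : ℕ} (v : EuclideanSpace ℝ (Fin d)) : Matrix (Fin d) (Fin d) ℝ :=
  Matrix.vecMulVec v.ofLp v.ofLp

/-- The norm `‖v‖_{M⁻¹} = √(vᵀ M⁻¹ v)`. -/
def invNorm {d : ℕ} (M : Matrix (Fin d) (Fin d) ℝ) (v : EuclideanSpace ℝ (Fin d)) : ℝ :=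
  Real.sqrt (v.ofLp ⬝ᵥ (M⁻¹.mulVec v.ofLp))

/-- The confidence width `α_t` for the conversation frequency `b(t) = b * t`. -/
def alpha (d : ℕ) (b κ₂ : ℝ) (t : ℕ) : ℝ :=
  1 / (2 * κ₂) *
    Real.sqrt (2 * d * Real.log (1 + (b * t + t) / d) + 2 * Real.log t)

/-- The order of the length of the initial exploration phase; the noise parameter is
`σ = 1 / 2`. -/
def explorationOrder (d q T : ℕ) (b κ₂ lam δ : ℝ) : ℝ :=
  max (1 / κ₂ ^ 2 * (d * Real.log ((b * T + T) / d) + 4 * Real.log T))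
    (max (q / (1 / 2 : ℝ) ^ 2)
      (256 / (b * q * lam) * Real.log (128 * d / (δ * lam ^ 2))))

/-- The finitely-valued random variable `X` is measurable with respect to `m`. -/
def DiscreteMeasurable {Ω α : Type*} (m : MeasurableSpace Ω) (X : Ω → α) : Prop :=
  ∀ a, MeasurableSet[m] (X ⁻¹' {a})

/-- The finitely-valued random variable `X` has, conditionally on `m`, the probability mass
function `p ω`. -/
def HasCondPMF {Ω α : Type*} {m0 : MeasurableSpace Ω} (μ : Measure Ω) (m : MeasurableSpace Ω)
    (X : Ω → α) (p : Ω → α → ℝ) : Prop :=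
  ∀ a, μ[(X ⁻¹' {a}).indicator (fun _ => (1 : ℝ)) | m] =ᵐ[μ] fun ω => p ω a

/-- All quantities of a run: dimension `d`, `N` items (arms), `K` key-terms, assortments of size
at most `q`. Rounds are numbered from `1`. The laws they obey are in `IsRun`. -/
structure Run (Ω : Type*) (d N K q : ℕ) where
  /-- the unknown preference vector -/
  θstar : EuclideanSpace ℝ (Fin d)
  /-- weights of the bipartite graph between items and key-terms -/
  w : Fin N → Fin K → ℝ
  /-- item feature vectors -/
  x : ℕ → Ω → Fin N → EuclideanSpace ℝ (Fin d)
  /-- items available in a round -/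
  avail : ℕ → Ω → Finset (Fin N)
  /-- item revenues -/
  r : ℕ → Ω → Fin N → ℝ
  /-- barycentric spanner of the key-terms -/
  spanner : ℕ → Ω → Fin d → Fin K
  /-- rounds in which a conversation takes place -/
  conv : Set ℕ
  /-- the `q` key-terms drawn in a conversation -/
  draw : ℕ → Fin q → Ω → Fin K
  /-- key-term chosen by the user (`none`: no choice) -/
  keyAns : ℕ → Ω → Option (Fin K)
  /-- estimate of the preference vector -/
  θhat : ℕ → Ω → EuclideanSpace ℝ (Fin d)
  /-- offered assortment -/
  C : ℕ → Ω → Finset (Fin N)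
  /-- item chosen by the user (`none`: no choice) -/
  ans : ℕ → Ω → Option (Fin N)

namespace Run

variable {Ω : Type*} {d N K q : ℕ} (R : Run Ω d N K q)

/-- Feature vector of a key-term: weighted average of the features of its related items. -/
def xkey (t : ℕ) (ω : Ω) (k : Fin K) : EuclideanSpace ℝ (Fin d) :=
  (∑ a, R.w a k)⁻¹ • ∑ a, R.w a k • R.x t ω a

open Classical in
/-- The set of key-terms offered in round `t` (empty if there is no conversation). -/
def keySet (t : ℕ) (ω : Ω) : Finset (Fin K) :=
  if t ∈ R.conv then Finset.univ.image (fun j => R.draw t j ω) else ∅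

/-- Candidate assortments: sets of at most `q` available items. -/
def candidates (t : ℕ) (ω : Ω) : Finset (Finset (Fin N)) :=
  (R.avail t ω).powerset.filter (fun S => S.card ≤ q)

theorem candidates_nonempty (t : ℕ) (ω : Ω) : (R.candidates t ω).Nonempty :=
  ⟨∅, by simp [candidates]⟩

/-- The design matrix `M_t`: item feedback before round `t`, key-term feedback up to round `t`. -/
def design (t : ℕ) (ω : Ω) : Matrix (Fin d) (Fin d) ℝ :=
  ∑ s ∈ Finset.Ico 1 t, ∑ i ∈ R.C s ω, outer (R.x s ω i) +
    ∑ s ∈ Finset.Icc 1 t, ∑ k ∈ R.keySet s ω, outer (R.xkey s ω k)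

/-- The gradient of the log-likelihood in round `t`; the maximum likelihood estimator is its
zero. -/
def score (t : ℕ) (ω : Ω) (θ : EuclideanSpace ℝ (Fin d)) : EuclideanSpace ℝ (Fin d) :=
  ∑ s ∈ Finset.Ico 1 t, ∑ i ∈ R.C s ω,
      ((if R.ans s ω = some i then (1 : ℝ) else 0) -
        mnlProb (R.x s ω) (R.C s ω) θ (some i)) • R.x s ω i +
    ∑ s ∈ Finset.Icc 1 t, ∑ k ∈ R.keySet s ω,
      ((if R.keyAns s ω = some k then (1 : ℝ) else 0) -
        mnlProb (R.xkey s ω) (R.keySet s ω) θ (some k)) • R.xkey s ω k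

/-- The optimistic utility `z_{a,t}` of item `a`. -/
def ucb (b κ₂ : ℝ) (t : ℕ) (ω : Ω) (a : Fin N) : ℝ :=
  inner ℝ (R.x t ω a) (R.θhat t ω) + alpha d b κ₂ t * invNorm (R.design t ω) (R.x t ω a)

/-- The true expected revenue `∑_{j ∈ S} r_{j,t} p_j(S, θ_*)` of the assortment `S`. -/
def trueRevenue (t : ℕ) (ω : Ω) (S : Finset (Fin N)) : ℝ :=
  ∑ j ∈ S, R.r t ω j * mnlProb (R.x t ω) S R.θstar (some j)

/-- Cumulative regret over the rounds `1, …, T`. -/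
def regret (T : ℕ) (ω : Ω) : ℝ :=
  ∑ t ∈ Finset.Icc 1 T,
    ((R.candidates t ω).sup' (R.candidates_nonempty t ω) (R.trueRevenue t ω) -
      R.trueRevenue t ω (R.C t ω))

open Classical in
/-- `R` is a run over `T` rounds of the ConMNL algorithm, with `T₀` exploration rounds, in a
conversational multinomial-logit environment.

Round `t` has four stages. `ℱ (4 * t)`: the past, and the features, available items, revenues and
spanner of round `t`; `ℱ (4 * t + 1)`: also the key-terms drawn; `ℱ (4 * t + 2)`: also the
user's choice among them; `ℱ (4 * t + 3)`: also the assortment. The user's choice from the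
assortment is known from `ℱ (4 * (t + 1))` on. -/
structure IsRun {mΩ : MeasurableSpace Ω} (μ : Measure Ω) (ℱ : Filtration ℕ mΩ)
    (b κ₂ lam : ℝ) (T T₀ : ℕ) : Prop where
  -- the environment
  norm_θstar : ‖R.θstar‖ ≤ 1
  w_nonneg : ∀ a k, 0 ≤ R.w a k
  w_sum : ∀ a, ∑ k, R.w a k = 1
  w_pos : ∀ k, 0 < ∑ a, R.w a k
  x_meas : ∀ t ∈ Finset.Icc 1 T, ∀ a, Measurable[ℱ (4 * t)] fun ω => R.x t ω a
  avail_meas : ∀ t ∈ Finset.Icc 1 T, DiscreteMeasurable (ℱ (4 * t)) (R.avail t)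
  r_meas : ∀ t ∈ Finset.Icc 1 T, ∀ a, Measurable[ℱ (4 * t)] fun ω => R.r t ω a
  spanner_meas : ∀ t ∈ Finset.Icc 1 T, DiscreteMeasurable (ℱ (4 * t)) (R.spanner t)
  norm_x : ∀ t ∈ Finset.Icc 1 T, ∀ ω a, ‖R.x t ω a‖ ≤ 1
  abs_r : ∀ t ∈ Finset.Icc 1 T, ∀ ω a, |R.r t ω a| ≤ 1
  card_avail : ∀ t ∈ Finset.Icc 1 T, ∀ ω, q ≤ (R.avail t ω).card
  -- `κ₂` bounds `p_i(S, θ) p_0(S, θ)` from below on the unit ball around `θ_*`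
  kappa : ∀ t ∈ Finset.Icc 1 T, ∀ ω, ∀ S ∈ R.candidates t ω, ∀ i ∈ S, ∀ θ,
    ‖θ - R.θstar‖ ≤ 1 →
      κ₂ ≤ mnlProb (R.x t ω) S θ (some i) * mnlProb (R.x t ω) S θ none
  spanner_spec : ∀ t ∈ Finset.Icc 1 T, ∀ ω k, ∃ c : Fin d → ℝ,
    (∀ i, c i ∈ Set.Icc (-1 : ℝ) 1) ∧ R.xkey t ω k = ∑ i, c i • R.xkey t ω (R.spanner t ω i)
  -- `lam` bounds the least eigenvalue of the mean of `x̃_k x̃_kᵀ` over the spanner from below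
  lambda_min : ∀ t ∈ Finset.Icc 1 T, ∀ ω,
    ((d : ℝ)⁻¹ • ∑ i, outer (R.xkey t ω (R.spanner t ω i)) -
      lam • (1 : Matrix (Fin d) (Fin d) ℝ)).PosSemidef
  -- conversations: at least `⌊b t⌋` of the first `t` rounds
  conv_freq : ∀ t ∈ Finset.Icc 1 T,
    ⌊b * t⌋₊ ≤ ((Finset.Icc 1 t).filter (fun s => s ∈ R.conv)).card
  -- each of the `q` key-terms is drawn uniformly from the spanner
  draw_meas : ∀ t ∈ Finset.Icc 1 T, t ∈ R.conv → ∀ j,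
    DiscreteMeasurable (ℱ (4 * t + 1)) (R.draw t j)
  draw_law : ∀ t ∈ Finset.Icc 1 T, t ∈ R.conv → ∀ j,
    HasCondPMF μ (ℱ (4 * t)) (R.draw t j) fun ω k =>
      ((Finset.univ.filter (fun i => R.spanner t ω i = k)).card : ℝ) / d
  keyAns_meas : ∀ t ∈ Finset.Icc 1 T, t ∈ R.conv →
    DiscreteMeasurable (ℱ (4 * t + 2)) (R.keyAns t)
  keyAns_law : ∀ t ∈ Finset.Icc 1 T, t ∈ R.conv →
    HasCondPMF μ (ℱ (4 * t + 1)) (R.keyAns t) fun ω =>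
      mnlProb (R.xkey t ω) (R.keySet t ω) R.θstar
  -- assortments and the user's choices from them
  C_meas : ∀ t ∈ Finset.Icc 1 T, DiscreteMeasurable (ℱ (4 * t + 3)) (R.C t)
  ans_meas : ∀ t ∈ Finset.Icc 1 T, DiscreteMeasurable (ℱ (4 * (t + 1))) (R.ans t)
  ans_law : ∀ t ∈ Finset.Icc 1 T,
    HasCondPMF μ (ℱ (4 * t + 3)) (R.ans t) fun ω => mnlProb (R.x t ω) (R.C t ω) R.θstar
  -- exploration phase: a uniformly random assortment of size `q`
  explore : ∀ t ∈ Finset.Icc 1 T, t ≤ T₀ →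
    HasCondPMF μ (ℱ (4 * t + 2)) (R.C t) fun ω S =>
      if S ∈ (R.avail t ω).powersetCard q then 1 / ((R.avail t ω).card.choose q : ℝ) else 0
  -- main phase: the maximum likelihood estimate, if there is one, and an assortment that is
  -- optimal for the optimistic utilities, if these are defined
  mle : ∀ t ∈ Finset.Icc 1 T, T₀ < t → ∀ ω,
    (∃ θ, R.score t ω θ = 0) → R.score t ω (R.θhat t ω) = 0
  C_mem : ∀ t ∈ Finset.Icc 1 T, T₀ < t → ∀ ω, R.C t ω ∈ R.candidates t ω
  C_opt : ∀ t ∈ Finset.Icc 1 T, T₀ < t → ∀ ω, (R.design t ω).det ≠ 0 →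
    ∀ S ∈ R.candidates t ω,
      revenue (R.r t ω) (R.ucb b κ₂ t ω) S ≤ revenue (R.r t ω) (R.ucb b κ₂ t ω) (R.C t ω)

end Run

end

end ConMNL

namespace ConMNL

noncomputable section

/-! The constant may depend on `κ₂` and `lam`, and these two numbers bound the problem size.
Features have norm at most one, so comparing traces gives `lam * d ≤ 1`; the choice probabilities of
`q` items are each at least `κ₂`, so `κ₂ * q ≤ 1`. Any dependence on `d` and `q` is therefore
harmless, and it suffices to show that the expected regret of a main-phase round `t` is O(√(log T /
t)). Summing 1/√t gives O(√(T log T)). Each exploration round costs at most 2, and there are only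
O(log T) of them, because `δ ≥ δ₀ / T²`.

For one round, the key-terms alone supply the information. About `b t` conversations have taken
place, each adding at least `lam` to the design in mean, so up to fluctuations the design dominates
a multiple `m` of the identity, with `m` of order `t`. The log-likelihood is concave, and within
distance 1 of `θ_*` the key-terms make it strongly concave with modulus `curvature * m`. If the
score at `θ_*` is smaller than that modulus, the likelihood equation has a solution and every
solution lies within ‖score‖ / (`curvature * m`) of `θ_*` (`exists_zero_of_strong`,
`norm_sub_le_of_zero`). The bonus is at most `alpha / √m`, so all optimistic utilities are close to
the true ones; since revenue is Lipschitz in the utilities (`revenue_le_add`), the chosen assortment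
is nearly optimal (`Run.IsRun.roundRegret_le_of_coercive`). The width `alpha` only has to be small
here; optimism is never needed.

No concentration inequality is needed. Where the design or the score misbehaves, the trivial bound 2
is at most a multiple of the noise divided by `m`, so regret is bounded pointwise by an expression
linear in the absolute noise (`Run.IsRun.roundRegret_le`). The noises are sums of bounded martingale
differences, whose first absolute moment is O(√t) by orthogonality (`integral_abs_sum_centered_le`);
divided by `m` this is O(1/√t). -/

/-! ### Concavity of the multinomial-logit log-likelihood. -/

/-- Over the common denominator, the right side exceeds the left by a Chebyshev-type covariance of
`u` and `exp u`, which is nonnegative because `exp` is increasing. What remains comes from the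
outside option, the summand 1, and is the source of strong concavity. -/
theorem sum_mul_exp_sub_one_mul_le {ι : Type} (C : Finset ι) (w u : ι → ℝ)
    (hw : ∀ i ∈ C, 0 < w i) :
    (∑ i ∈ C, w i * (Real.exp (u i) - 1) * u i) /
        ((1 + ∑ i ∈ C, w i) * (1 + ∑ i ∈ C, w i * Real.exp (u i))) ≤
      ∑ i ∈ C, (w i * Real.exp (u i) / (1 + ∑ i ∈ C, w i * Real.exp (u i)) -
        w i / (1 + ∑ i ∈ C, w i)) * u i := by
  set W := ∑ i ∈ C, w i with hW
  set V := ∑ i ∈ C, w i * Real.exp (u i) with hV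
  have hW0 : 0 ≤ W := Finset.sum_nonneg fun i hi => (hw i hi).le
  have hV0 : 0 ≤ V := Finset.sum_nonneg fun i hi => (mul_pos (hw i hi) (Real.exp_pos _)).le
  -- Symmetrised form of the covariance: both differences always have the same sign.
  have key : 0 ≤ ∑ i ∈ C, ∑ j ∈ C,
      w i * w j * ((Real.exp (u i) - Real.exp (u j)) * (u i - u j)) := by
    refine Finset.sum_nonneg fun i hi => Finset.sum_nonneg fun j hj => ?_
    refine mul_nonneg (mul_pos (hw i hi) (hw j hj)).le ?_
    rcases le_total (u i) (u j) with h | h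
    · exact mul_nonneg_of_nonpos_of_nonpos (sub_nonpos.2 (Real.exp_le_exp.2 h)) (sub_nonpos.2 h)
    · exact mul_nonneg (sub_nonneg.2 (Real.exp_le_exp.2 h)) (sub_nonneg.2 h)
  set U := ∑ i ∈ C, w i * u i with hU
  set P := ∑ i ∈ C, w i * Real.exp (u i) * u i with hP
  have key2 : ∑ i ∈ C, ∑ j ∈ C,
      w i * w j * ((Real.exp (u i) - Real.exp (u j)) * (u i - u j)) =
        2 * (P * W - V * U) := by
    have : ∀ i ∈ C, ∑ j ∈ C, w i * w j * ((Real.exp (u i) - Real.exp (u j)) * (u i - u j)) =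
        w i * Real.exp (u i) * u i * W - w i * Real.exp (u i) * U - w i * u i * V + w i * P := by
      intro i _
      rw [hW, hU, hV, hP, Finset.mul_sum, Finset.mul_sum, Finset.mul_sum, Finset.mul_sum,
        ← Finset.sum_sub_distrib, ← Finset.sum_sub_distrib, ← Finset.sum_add_distrib]
      exact Finset.sum_congr rfl fun j _ => by ring
    rw [Finset.sum_congr rfl this, Finset.sum_add_distrib, Finset.sum_sub_distrib,
      Finset.sum_sub_distrib, ← Finset.sum_mul, ← Finset.sum_mul, ← Finset.sum_mul,
      ← Finset.sum_mul]
    ring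
  have e1 : ∑ i ∈ C, w i * (Real.exp (u i) - 1) * u i = P - U := by
    rw [hP, hU, ← Finset.sum_sub_distrib]
    exact Finset.sum_congr rfl fun j _ => by ring
  have e2 : ∑ i ∈ C, (w i * Real.exp (u i) / (1 + V) - w i / (1 + W)) * u i =
      P / (1 + V) - U / (1 + W) := by
    rw [hP, hU, Finset.sum_div, Finset.sum_div, ← Finset.sum_sub_distrib]
    exact Finset.sum_congr rfl fun j _ => by ring
  rw [e1, e2, div_sub_div _ _ (by positivity) (by positivity), mul_comm (1 + W) (1 + V)]
  refine div_le_div_of_nonneg_right ?_ (by positivity)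
  rw [key2] at key
  linarith

theorem exp_neg_one_mul_sq_le {u : ℝ} (hu : |u| ≤ 1) :
    Real.exp (-1) * u ^ 2 ≤ (Real.exp u - 1) * u := by
  have h1 : Real.exp (-1) ≤ 1 := Real.exp_le_one_iff.2 (by norm_num)
  rcases le_total 0 u with h | h
  · have := Real.add_one_le_exp u
    have h2 : u * u ≤ (Real.exp u - 1) * u := by gcongr; linarith
    have h3 : Real.exp (-1) * u ^ 2 ≤ 1 * u ^ 2 := by gcongr
    nlinarith
  · have h2 := Real.add_one_le_exp (-u)
    have h3 : Real.exp (-1) ≤ Real.exp u := Real.exp_le_exp.2 (abs_le.1 hu).1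
    have h4 : Real.exp u * Real.exp (-u) = 1 := by rw [← Real.exp_add]; simp
    have h5 : Real.exp u * (-u) ≤ 1 - Real.exp u := by nlinarith [Real.exp_pos u]
    have h6 : Real.exp (-1) * (-u) ≤ 1 - Real.exp u := by nlinarith
    nlinarith

theorem exp_sub_one_mul_nonneg (u : ℝ) : 0 ≤ (Real.exp u - 1) * u := by
  rcases le_total 0 u with h | h
  · exact mul_nonneg (sub_nonneg.2 (Real.one_le_exp h)) h
  · exact mul_nonneg_of_nonpos_of_nonpos (sub_nonpos.2 (Real.exp_le_one_iff.2 h)) h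

section mnl

variable {d : ℕ} {ι : Type} [DecidableEq ι]

theorem mnlProb_nonneg (x : ι → EuclideanSpace ℝ (Fin d)) (C : Finset ι)
    (θ : EuclideanSpace ℝ (Fin d)) (a : Option ι) : 0 ≤ mnlProb x C θ a := by
  cases a with
  | none => simp only [mnlProb]; positivity
  | some i => simp only [mnlProb]; split_ifs <;> positivity

theorem sum_mnlProb_some (x : ι → EuclideanSpace ℝ (Fin d)) (C : Finset ι)
    (θ : EuclideanSpace ℝ (Fin d)) :
    ∑ i ∈ C, mnlProb x C θ (some i) = 1 - mnlProb x C θ none := by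
  have h : (1 + ∑ j ∈ C, Real.exp (inner ℝ (x j) θ)) ≠ 0 := by positivity
  have : ∑ i ∈ C, mnlProb x C θ (some i) =
      ∑ i ∈ C, Real.exp (inner ℝ (x i) θ) / (1 + ∑ j ∈ C, Real.exp (inner ℝ (x j) θ)) :=
    Finset.sum_congr rfl fun i hi => by simp [mnlProb, hi]
  rw [this, ← Finset.sum_div]
  simp only [mnlProb]
  field_simp
  ring

theorem sum_mnlProb [Fintype ι] (x : ι → EuclideanSpace ℝ (Fin d)) (C : Finset ι)
    (θ : EuclideanSpace ℝ (Fin d)) : ∑ a, mnlProb x C θ a = 1 := by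
  have h : ∑ i, mnlProb x C θ (some i) = ∑ i ∈ C, mnlProb x C θ (some i) :=
    (Finset.sum_subset (Finset.subset_univ C) fun i _ hi => by simp [mnlProb, hi]).symm
  rw [Fintype.sum_option, h, sum_mnlProb_some]
  ring

/-- Gradient of the log-likelihood of one multinomial-logit choice `o` from `C`. -/
def gradLL (x : ι → EuclideanSpace ℝ (Fin d)) (C : Finset ι) (o : Option ι)
    (θ : EuclideanSpace ℝ (Fin d)) : EuclideanSpace ℝ (Fin d) :=
  ∑ i ∈ C, ((if o = some i then (1 : ℝ) else 0) - mnlProb x C θ (some i)) • x i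

/-- Log-likelihood of one multinomial-logit choice `o` from `C`. -/
def logLik (x : ι → EuclideanSpace ℝ (Fin d)) (C : Finset ι) (o : Option ι)
    (θ : EuclideanSpace ℝ (Fin d)) : ℝ :=
  ∑ i ∈ C, (if o = some i then (1 : ℝ) else 0) * inner ℝ (x i) θ -
    Real.log (1 + ∑ i ∈ C, Real.exp (inner ℝ (x i) θ))

theorem hasFDerivAt_logLik (x : ι → EuclideanSpace ℝ (Fin d)) (C : Finset ι) (o : Option ι)
    (θ : EuclideanSpace ℝ (Fin d)) :
    HasFDerivAt (logLik x C o) (innerSL ℝ (gradLL x C o θ)) θ := by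
  have hin : ∀ i, HasFDerivAt (fun θ => inner ℝ (x i) θ) (innerSL ℝ (x i)) θ := fun i =>
    (innerSL ℝ (x i)).hasFDerivAt
  have h1 : HasFDerivAt (fun θ => ∑ i ∈ C, (if o = some i then (1 : ℝ) else 0) * inner ℝ (x i) θ)
      (∑ i ∈ C, (if o = some i then (1 : ℝ) else 0) • innerSL ℝ (x i)) θ :=
    HasFDerivAt.fun_sum fun i _ => (hin i).const_mul _
  have h2 : HasFDerivAt (fun θ => 1 + ∑ i ∈ C, Real.exp (inner ℝ (x i) θ))
      (∑ i ∈ C, Real.exp (inner ℝ (x i) θ) • innerSL ℝ (x i)) θ :=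
    (HasFDerivAt.fun_sum fun i _ => (hin i).exp).const_add 1
  have h3 := h1.sub (h2.log (by positivity))
  refine h3.congr_fderiv ?_
  simp only [gradLL, map_sum, map_smul]
  rw [Finset.smul_sum, ← Finset.sum_sub_distrib]
  refine Finset.sum_congr rfl fun i hi => ?_
  simp only [mnlProb, hi, if_true]
  rw [sub_smul, smul_smul, div_eq_inv_mul]

/-- The observed choice cancels in the difference of gradients, leaving a difference of
probabilities to which `sum_mul_exp_sub_one_mul_le` applies with weights `exp ⟨x i, θ⟩`. -/
theorem inner_gradLL_sub (x : ι → EuclideanSpace ℝ (Fin d)) (C : Finset ι) (o : Option ι)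
    (θ v : EuclideanSpace ℝ (Fin d)) :
    (∑ i ∈ C, Real.exp (inner ℝ (x i) θ) * (Real.exp (inner ℝ (x i) v) - 1) * inner ℝ (x i) v) /
        ((1 + ∑ i ∈ C, Real.exp (inner ℝ (x i) θ)) *
          (1 + ∑ i ∈ C, Real.exp (inner ℝ (x i) (θ + v)))) ≤
      inner ℝ (gradLL x C o θ) v - inner ℝ (gradLL x C o (θ + v)) v := by
  have h := sum_mul_exp_sub_one_mul_le C (fun i => Real.exp (inner ℝ (x i) θ))
    (fun i => inner ℝ (x i) v) (fun i _ => Real.exp_pos _)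
  have e : ∀ i, Real.exp (inner ℝ (x i) (θ + v)) =
      Real.exp (inner ℝ (x i) θ) * Real.exp (inner ℝ (x i) v) := fun i => by
    rw [inner_add_right, Real.exp_add]
  simp only [e]
  refine h.trans (le_of_eq ?_)
  rw [← inner_sub_left]
  simp only [gradLL]
  rw [← Finset.sum_sub_distrib, sum_inner]
  refine Finset.sum_congr rfl fun i hi => ?_
  rw [← sub_smul, real_inner_smul_left]
  simp only [mnlProb, hi, if_true, e]
  ring

theorem inner_gradLL_antitone (x : ι → EuclideanSpace ℝ (Fin d)) (C : Finset ι) (o : Option ι)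
    (θ v : EuclideanSpace ℝ (Fin d)) :
    inner ℝ (gradLL x C o (θ + v)) v ≤ inner ℝ (gradLL x C o θ) v := by
  have h := inner_gradLL_sub x C o θ v
  have h0 : 0 ≤ (∑ i ∈ C, Real.exp (inner ℝ (x i) θ) * (Real.exp (inner ℝ (x i) v) - 1) *
      inner ℝ (x i) v) / ((1 + ∑ i ∈ C, Real.exp (inner ℝ (x i) θ)) *
          (1 + ∑ i ∈ C, Real.exp (inner ℝ (x i) (θ + v)))) := by
    refine div_nonneg (Finset.sum_nonneg fun i _ => ?_) (by positivity)
    rw [mul_assoc]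
    exact mul_nonneg (Real.exp_pos _).le (exp_sub_one_mul_nonneg _)
  linarith

/-- Strong concavity constant at a parameter of norm at most one, for sets of at most `n` objects
with features of norm at most one. -/
def curvature (n : ℝ) : ℝ :=
  Real.exp (-2) / ((1 + n * Real.exp 1) * (1 + n * Real.exp 2))

theorem curvature_pos {n : ℝ} (hn : 0 ≤ n) : 0 < curvature n := by
  unfold curvature; positivity

/-- All terms of the lower bound in `inner_gradLL_sub` are nonnegative, so a single object `k` may
be kept. For a conversation, `k` will be one fixed draw. -/
theorem inner_gradLL_strong (x : ι → EuclideanSpace ℝ (Fin d)) (C : Finset ι) (o : Option ι)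
    {θ v : EuclideanSpace ℝ (Fin d)} (hx : ∀ i ∈ C, ‖x i‖ ≤ 1) (hθ : ‖θ‖ ≤ 1) (hv : ‖v‖ ≤ 1)
    {n : ℝ} (hn : (C.card : ℝ) ≤ n) {k : ι} (hk : k ∈ C) :
    inner ℝ (gradLL x C o (θ + v)) v + curvature n * (inner ℝ (x k) v) ^ 2 ≤
      inner ℝ (gradLL x C o θ) v := by
  have h := inner_gradLL_sub x C o θ v
  have hn0 : 0 ≤ n := (Nat.cast_nonneg _).trans hn
  have hin : ∀ i ∈ C, ∀ y : EuclideanSpace ℝ (Fin d), |inner ℝ (x i) y| ≤ ‖y‖ := fun i hi y =>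
    (abs_real_inner_le_norm _ _).trans (mul_le_of_le_one_left (norm_nonneg _) (hx i hi))
  have hsum : ∀ y : EuclideanSpace ℝ (Fin d), ∀ r : ℝ, ‖y‖ ≤ r →
      ∑ i ∈ C, Real.exp (inner ℝ (x i) y) ≤ n * Real.exp r := by
    intro y r hr
    calc ∑ i ∈ C, Real.exp (inner ℝ (x i) y) ≤ ∑ _i ∈ C, Real.exp r :=
          Finset.sum_le_sum fun i hi =>
            Real.exp_le_exp.2 ((le_abs_self _).trans ((hin i hi y).trans hr))
      _ = C.card * Real.exp r := by simp
      _ ≤ n * Real.exp r := by gcongr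
  have hW := hsum θ 1 hθ
  have hV := hsum (θ + v) 2 ((norm_add_le _ _).trans (by linarith))
  -- One factor `exp (-1)` bounds the weight of `k` at `θ`, the other comes from
  -- `exp_neg_one_mul_sq_le`.
  have hterm : Real.exp (-2) * (inner ℝ (x k) v) ^ 2 ≤ ∑ i ∈ C, Real.exp (inner ℝ (x i) θ) *
      (Real.exp (inner ℝ (x i) v) - 1) * inner ℝ (x i) v := by
    have hnn : ∀ i ∈ C, 0 ≤ Real.exp (inner ℝ (x i) θ) *
        (Real.exp (inner ℝ (x i) v) - 1) * inner ℝ (x i) v := fun i _ => by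
      rw [mul_assoc]
      exact mul_nonneg (Real.exp_pos _).le (exp_sub_one_mul_nonneg _)
    refine le_trans ?_ (Finset.single_le_sum hnn hk)
    have e2 : Real.exp (-2) = Real.exp (-1) * Real.exp (-1) := by
      rw [← Real.exp_add]; norm_num
    rw [e2, mul_assoc, mul_assoc]
    exact mul_le_mul (Real.exp_le_exp.2 (abs_le.1 ((hin k hk θ).trans hθ)).1)
      (exp_neg_one_mul_sq_le ((hin k hk v).trans hv)) (by positivity) (Real.exp_pos _).le
  have : curvature n * (inner ℝ (x k) v) ^ 2 ≤ (∑ i ∈ C, Real.exp (inner ℝ (x i) θ) *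
      (Real.exp (inner ℝ (x i) v) - 1) * inner ℝ (x i) v) /
        ((1 + ∑ i ∈ C, Real.exp (inner ℝ (x i) θ)) *
          (1 + ∑ i ∈ C, Real.exp (inner ℝ (x i) (θ + v)))) := by
    unfold curvature
    rw [div_mul_eq_mul_div]
    gcongr
    exact le_trans (by positivity) hterm
  linarith

end mnl

/-! ### Existence and location of zeros of a monotone gradient field. -/

section zero

variable {E : Type*} [NormedAddCommGroup E] [InnerProductSpace ℝ E] {F : E → E} {θ₀ : E} {m : ℝ}

/-- A zero of a monotone gradient field that is strongly monotone around `θ₀` lies near `θ₀`. -/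
theorem norm_sub_le_of_zero (hm : 0 < m)
    (hmono : ∀ θ v, inner ℝ (F (θ + v)) v ≤ inner ℝ (F θ) v)
    (hstrong : ∀ v, ‖v‖ ≤ 1 → inner ℝ (F (θ₀ + v)) v + m * ‖v‖ ^ 2 ≤ inner ℝ (F θ₀) v)
    (hsmall : ‖F θ₀‖ < m) {θ : E} (hθ : F θ = 0) : ‖θ - θ₀‖ ≤ ‖F θ₀‖ / m := by
  set v := θ - θ₀ with hv
  have hθv : θ = θ₀ + v := by simp [hv]
  rcases le_or_gt ‖v‖ 1 with h1 | h1
  · have h := hstrong v h1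
    rw [← hθv, hθ, inner_zero_left] at h
    have h2 := real_inner_le_norm (F θ₀) v
    rw [le_div_iff₀ hm]
    rcases (norm_nonneg v).eq_or_lt with h0 | h0
    · rw [← h0]; simp
    · have : m * ‖v‖ * ‖v‖ ≤ ‖F θ₀‖ * ‖v‖ := by nlinarith
      linarith [le_of_mul_le_mul_right this h0]
  -- A far zero is excluded along its ray: at distance 1 strong monotonicity makes the outward
  -- component of `F` negative, and monotonicity keeps it from returning to 0.
  · exfalso
    set e := ‖v‖⁻¹ • v with he
    have hv0 : 0 < ‖v‖ := by linarith
    have hve : v = ‖v‖ • e := by rw [he, smul_smul, mul_inv_cancel₀ hv0.ne', one_smul]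
    have hen : ‖e‖ = 1 := by
      rw [he, norm_smul, norm_inv, norm_norm, inv_mul_cancel₀ hv0.ne']
    have h := hstrong e hen.le
    have h2 := hmono (θ₀ + e) ((‖v‖ - 1) • e)
    have h3 : θ₀ + e + (‖v‖ - 1) • e = θ := by
      rw [hθv, sub_smul, ← hve, one_smul]; abel
    rw [h3, hθ, inner_zero_left, real_inner_smul_right] at h2
    have h4 : 0 ≤ inner ℝ (F (θ₀ + e)) e := nonneg_of_mul_nonneg_right h2 (by linarith)
    have h5 := real_inner_le_norm (F θ₀) e
    rw [hen] at h h5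
    linarith

/-- A maximiser of `L` on the closed unit ball around `θ₀` is interior, because on the boundary `L`
strictly increases towards the centre; an interior maximiser is critical. -/
theorem exists_zero_of_strong [FiniteDimensional ℝ E] {L : E → ℝ}
    (hL : ∀ θ, HasFDerivAt L (innerSL ℝ (F θ)) θ)
    (hstrong : ∀ v, ‖v‖ ≤ 1 → inner ℝ (F (θ₀ + v)) v + m * ‖v‖ ^ 2 ≤ inner ℝ (F θ₀) v)
    (hsmall : ‖F θ₀‖ < m) : ∃ θ, F θ = 0 := by
  have : ProperSpace E := FiniteDimensional.proper ℝ E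
  have hcont : Continuous L := continuous_iff_continuousAt.2 fun θ => (hL θ).continuousAt
  obtain ⟨θ, hθmem, hθmax⟩ := (isCompact_closedBall θ₀ (1 : ℝ)).exists_isMaxOn
    (Metric.nonempty_closedBall.2 zero_le_one) hcont.continuousOn
  refine ⟨θ, ?_⟩
  set v := θ - θ₀ with hv
  have hθv : θ = θ₀ + v := by simp [hv]
  have hv1 : ‖v‖ ≤ 1 := by rwa [Metric.mem_closedBall, dist_eq_norm] at hθmem
  have hlt : ‖v‖ < 1 := by
    by_contra hcon
    have hv1 : ‖v‖ = 1 := le_antisymm hv1 (not_lt.1 hcon)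
    have hseg : segment ℝ θ θ₀ ⊆ Metric.closedBall θ₀ (1 : ℝ) :=
      (convex_closedBall θ₀ 1).segment_subset hθmem (Metric.mem_closedBall_self zero_le_one)
    have h := IsLocalMaxOn.hasFDerivWithinAt_nonpos hθmax.localize (hL θ).hasFDerivWithinAt
      (sub_mem_posTangentConeAt_of_segment_subset hseg)
    have h2 : θ₀ - θ = -v := by simp [hv]
    rw [h2, map_neg, innerSL_apply_apply] at h
    have h3 := hstrong v hv1.le
    rw [← hθv, hv1] at h3
    have h4 := real_inner_le_norm (F θ₀) v
    rw [hv1] at h4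
    linarith
  have hloc : IsLocalMax L θ :=
    hθmax.isLocalMax (Metric.closedBall_mem_nhds_of_mem (by rwa [Metric.mem_ball, dist_eq_norm]))
  have h0 := hloc.hasFDerivAt_eq_zero (hL θ)
  have h1 : innerSL ℝ (F θ) (F θ) = 0 := by rw [h0]; rfl
  rwa [innerSL_apply_apply, inner_self_eq_zero] at h1

end zero

/-! ### Stability of the revenue under perturbed utilities. -/

theorem revenue_le_add {N : ℕ} {r z z' : Fin N → ℝ} {ε : ℝ} (hε : 0 ≤ ε) (hr : ∀ i, |r i| ≤ 1)
    (hz : ∀ i, |z i - z' i| ≤ ε) (S : Finset (Fin N)) :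
    revenue r z S ≤ revenue r z' S + 4 * ε := by
  -- Shifting all revenues by 1, including that of the outside option, makes every numerator term
  -- nonnegative. Numerator and denominator then each change by a factor of at most `exp ε`. The
  -- shifted revenue is at most 2, whence the constant 4.
  have expand : ∀ z : Fin N → ℝ, revenue r z S + 1 =
      (1 + ∑ i ∈ S, (r i + 1) * Real.exp (z i)) / (1 + ∑ i ∈ S, Real.exp (z i)) := by
    intro z
    have : (1 + ∑ i ∈ S, Real.exp (z i)) ≠ 0 := by positivity
    simp only [revenue, add_mul, Finset.sum_add_distrib, one_mul]
    field_simp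
    ring
  have hr1 : ∀ i, 0 ≤ r i + 1 := fun i => by linarith [(abs_le.1 (hr i)).1]
  have hr2 : ∀ i, r i ≤ 1 := fun i => (abs_le.1 (hr i)).2
  have e1 : ∀ i, Real.exp (-ε) * Real.exp (z i) ≤ Real.exp (z' i) := fun i => by
    rw [← Real.exp_add]
    exact Real.exp_le_exp.2 (by linarith [(abs_le.1 (hz i)).2])
  have e2 : ∀ i, Real.exp (-ε) * Real.exp (z' i) ≤ Real.exp (z i) := fun i => by
    rw [← Real.exp_add]
    exact Real.exp_le_exp.2 (by linarith [(abs_le.1 (hz i)).1])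
  have e0 : Real.exp (-ε) ≤ 1 := Real.exp_le_one_iff.2 (by linarith)
  have hnum : Real.exp (-ε) * (1 + ∑ i ∈ S, (r i + 1) * Real.exp (z i)) ≤
      1 + ∑ i ∈ S, (r i + 1) * Real.exp (z' i) := by
    rw [mul_add, mul_one, Finset.mul_sum]
    refine add_le_add e0 (Finset.sum_le_sum fun i _ => ?_)
    nlinarith [mul_le_mul_of_nonneg_left (e1 i) (hr1 i)]
  have hden : Real.exp (-ε) * (1 + ∑ i ∈ S, Real.exp (z' i)) ≤
      1 + ∑ i ∈ S, Real.exp (z i) := by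
    rw [mul_add, mul_one, Finset.mul_sum]
    exact add_le_add e0 (Finset.sum_le_sum fun i _ => e2 i)
  have hmain : Real.exp (-ε) * Real.exp (-ε) * (revenue r z S + 1) ≤ revenue r z' S + 1 := by
    rw [expand, expand, ← mul_div_assoc, div_le_div_iff₀ (by positivity) (by positivity)]
    have hn : 0 ≤ 1 + ∑ i ∈ S, (r i + 1) * Real.exp (z i) := by
      have : ∀ i ∈ S, 0 ≤ (r i + 1) * Real.exp (z i) := fun i _ =>
        mul_nonneg (hr1 i) (Real.exp_pos _).le
      have := Finset.sum_nonneg this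
      linarith
    have := mul_le_mul hnum hden (by positivity) (le_trans (by positivity) hnum)
    nlinarith
  have hle : revenue r z S + 1 ≤ 2 := by
    rw [expand, div_le_iff₀ (by positivity), mul_add, Finset.mul_sum]
    have : ∑ i ∈ S, (r i + 1) * Real.exp (z i) ≤ ∑ i ∈ S, 2 * Real.exp (z i) :=
      Finset.sum_le_sum fun i _ => by gcongr; linarith [hr2 i]
    linarith
  have hge : 0 ≤ revenue r z S + 1 := by
    rw [expand]
    have : ∀ i ∈ S, 0 ≤ (r i + 1) * Real.exp (z i) := fun i _ =>
        mul_nonneg (hr1 i) (Real.exp_pos _).le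
    have := Finset.sum_nonneg this
    positivity
  have hexp : 1 - 2 * ε ≤ Real.exp (-ε) * Real.exp (-ε) := by
    rw [← Real.exp_add]; linarith [Real.add_one_le_exp (-ε + -ε)]
  nlinarith

theorem abs_revenue_le {N : ℕ} {r : Fin N → ℝ} (hr : ∀ i, |r i| ≤ 1) (z : Fin N → ℝ)
    (S : Finset (Fin N)) : |revenue r z S| ≤ 1 := by
  have h : (0 : ℝ) < 1 + ∑ i ∈ S, Real.exp (z i) := by positivity
  rw [revenue, abs_div, abs_of_pos h, div_le_one h]
  refine (Finset.abs_sum_le_sum_abs _ _).trans ?_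
  have : ∑ i ∈ S, |r i * Real.exp (z i)| ≤ ∑ i ∈ S, Real.exp (z i) :=
    Finset.sum_le_sum fun i _ => by
      rw [abs_mul, Real.abs_exp]
      exact mul_le_of_le_one_left (Real.exp_pos _).le (hr i)
  linarith

/-! ### Coercive matrices and quadratic forms. -/

section matrix

variable {d : ℕ}

theorem dotProduct_outer_mulVec (v y : EuclideanSpace ℝ (Fin d)) :
    y.ofLp ⬝ᵥ ((outer v).mulVec y.ofLp) = (inner ℝ v y) ^ 2 := by
  rw [outer, Matrix.vecMulVec_mulVec, EuclideanSpace.inner_eq_star_dotProduct]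
  simp [dotProduct_smul, dotProduct_comm, sq]

theorem dotProduct_self_eq (y : EuclideanSpace ℝ (Fin d)) : y.ofLp ⬝ᵥ y.ofLp = ‖y‖ ^ 2 := by
  rw [← real_inner_self_eq_norm_sq, EuclideanSpace.inner_eq_star_dotProduct]
  simp

theorem det_ne_zero_of_coercive {M : Matrix (Fin d) (Fin d) ℝ} {m : ℝ} (hm : 0 < m)
    (hM : ∀ y : EuclideanSpace ℝ (Fin d), m * ‖y‖ ^ 2 ≤ y.ofLp ⬝ᵥ (M.mulVec y.ofLp)) :
    M.det ≠ 0 := by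
  intro h
  obtain ⟨v, hv, hv0⟩ := Matrix.exists_mulVec_eq_zero_iff.2 h
  have := hM (WithLp.toLp 2 v)
  simp only [hv0, dotProduct_zero] at this
  have h2 : 0 < ‖WithLp.toLp 2 v‖ := norm_pos_iff.2 fun h => hv (by simpa using h)
  have : 0 < m * ‖WithLp.toLp 2 v‖ ^ 2 := by positivity
  linarith

theorem invNorm_le_of_coercive {M : Matrix (Fin d) (Fin d) ℝ} {m : ℝ} (hm : 0 < m)
    (hM : ∀ y : EuclideanSpace ℝ (Fin d), m * ‖y‖ ^ 2 ≤ y.ofLp ⬝ᵥ (M.mulVec y.ofLp))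
    {x : EuclideanSpace ℝ (Fin d)} (hx : ‖x‖ ≤ 1) : invNorm M x ≤ 1 / Real.sqrt m := by
  have hdet : IsUnit M.det := isUnit_iff_ne_zero.2 (det_ne_zero_of_coercive hm hM)
  rw [invNorm, one_div, ← Real.sqrt_inv]
  refine Real.sqrt_le_sqrt ?_
  -- Testing coercivity at `y = M⁻¹ x` gives m‖y‖² ≤ ⟨x, y⟩ ≤ ‖y‖, so ‖y‖ ≤ 1/m.
  set y : EuclideanSpace ℝ (Fin d) := WithLp.toLp 2 (M⁻¹.mulVec x.ofLp) with hy
  have h1 := hM y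
  have h2 : M.mulVec y.ofLp = x.ofLp := by
    simp [hy, Matrix.mulVec_mulVec, Matrix.mul_nonsing_inv M hdet]
  rw [h2] at h1
  have h3 : x.ofLp ⬝ᵥ (M⁻¹.mulVec x.ofLp) = inner ℝ x y := by
    rw [EuclideanSpace.inner_eq_star_dotProduct, dotProduct_comm]; simp [hy]
  have h4 : y.ofLp ⬝ᵥ x.ofLp = inner ℝ x y := by
    rw [EuclideanSpace.inner_eq_star_dotProduct]; simp
  rw [h4] at h1
  rw [h3]
  have h5 : inner ℝ x y ≤ ‖y‖ := (real_inner_le_norm x y).trans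
    (mul_le_of_le_one_left (norm_nonneg _) hx)
  refine h5.trans ?_
  rw [← one_div, le_div_iff₀ hm]
  rcases (norm_nonneg y).eq_or_lt with h0 | h0
  · rw [← h0]; simp
  · nlinarith

/-- An entrywise bound replaces matrix concentration; the loss is polynomial in `d`, which is
bounded. -/
theorem abs_quadratic_le (D : Fin d → Fin d → ℝ) (y : EuclideanSpace ℝ (Fin d)) :
    |∑ i, ∑ j, D i j * (y i * y j)| ≤ (∑ i, ∑ j, |D i j|) * ‖y‖ ^ 2 := by
  have hy : ∀ i, |y i| ≤ ‖y‖ := fun i => by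
    simpa using PiLp.norm_apply_le y i
  rw [Finset.sum_mul]
  refine (Finset.abs_sum_le_sum_abs _ _).trans (Finset.sum_le_sum fun i _ => ?_)
  rw [Finset.sum_mul]
  refine (Finset.abs_sum_le_sum_abs _ _).trans (Finset.sum_le_sum fun j _ => ?_)
  rw [abs_mul, abs_mul, sq]
  have := mul_le_mul (hy i) (hy j) (abs_nonneg _) (norm_nonneg _)
  gcongr

end matrix

/-! ### First moments of sums of martingale differences. -/

section probability

variable {Ω α : Type*} {m mΩ : MeasurableSpace Ω} {μ : Measure Ω}

theorem DiscreteMeasurable.mono {X : Ω → α} {m' : MeasurableSpace Ω} (hm : m ≤ m')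
    (hX : DiscreteMeasurable m X) : DiscreteMeasurable m' X :=
  fun a => hm _ (hX a)

theorem aestronglyMeasurable_sum {ι : Type*} (s : Finset ι) {F : ι → Ω → ℝ}
    (hF : ∀ i ∈ s, AEStronglyMeasurable[m] (F i) μ) :
    AEStronglyMeasurable[m] (fun ω => ∑ i ∈ s, F i ω) μ := by
  classical
  induction s using Finset.induction_on with
  | empty => simpa using aestronglyMeasurable_const
  | insert i s hi ih =>
    simp only [Finset.sum_insert hi]
    exact (hF i (Finset.mem_insert_self i s)).add
      (ih fun j hj => hF j (Finset.mem_insert_of_mem hj))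

theorem DiscreteMeasurable.aestronglyMeasurable_comp [Finite α] {X : Ω → α} {F : α → Ω → ℝ}
    (hX : DiscreteMeasurable m X) (hF : ∀ a, AEStronglyMeasurable[m] (F a) μ) :
    AEStronglyMeasurable[m] (fun ω => F (X ω) ω) μ := by
  have := Fintype.ofFinite α
  classical
  have e : (fun ω => F (X ω) ω) = fun ω => ∑ a, (X ⁻¹' {a}).indicator (F a) ω := by
    funext ω
    rw [Finset.sum_eq_single (X ω)]
    · simp
    · intro a _ ha
      exact Set.indicator_of_notMem (fun h => ha (by simpa using h.symm)) _
    · simp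
  rw [e]
  exact aestronglyMeasurable_sum _ fun a _ => by
    obtain ⟨g, hg, hfg⟩ := hF a
    refine ⟨(X ⁻¹' {a}).indicator g, hg.indicator (hX a), ?_⟩
    refine hfg.mono fun ω hω => ?_
    by_cases h : ω ∈ X ⁻¹' {a} <;> simp [Set.indicator, hω]

theorem integral_abs_sum_le [IsProbabilityMeasure μ] {ξ : ℕ → Ω → ℝ} {B : ℝ} (hB : 0 ≤ B)
    (s : Finset ℕ) (hmeas : ∀ n ∈ s, AEStronglyMeasurable (ξ n) μ)
    (hbdd : ∀ n ∈ s, ∀ ω, |ξ n ω| ≤ B)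
    (horth : ∀ i ∈ s, ∀ j ∈ s, i < j → ∫ ω, ξ i ω * ξ j ω ∂μ = 0) :
    ∫ ω, |∑ n ∈ s, ξ n ω| ∂μ ≤ B * Real.sqrt s.card := by
  have hint2 : ∀ i ∈ s, ∀ j ∈ s, Integrable (fun ω => ξ i ω * ξ j ω) μ := fun i hi j hj =>
    Integrable.of_bound ((hmeas i hi).mul (hmeas j hj)) (B * B)
      (Filter.Eventually.of_forall fun ω => by
        rw [Real.norm_eq_abs, abs_mul]
        exact mul_le_mul (hbdd i hi ω) (hbdd j hj ω) (abs_nonneg _) hB)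
  have hsum : AEStronglyMeasurable (fun ω => ∑ n ∈ s, ξ n ω) μ :=
    aestronglyMeasurable_sum _ hmeas
  have hexp : ∀ ω, (∑ n ∈ s, ξ n ω) ^ 2 = ∑ i ∈ s, ∑ j ∈ s, ξ i ω * ξ j ω := fun ω => by
    rw [sq, Finset.sum_mul_sum]
  have hsq : ∫ ω, (∑ n ∈ s, ξ n ω) ^ 2 ∂μ ≤ s.card * B ^ 2 := by
    simp only [hexp]
    rw [integral_finsetSum _ fun i hi => integrable_finsetSum _ fun j hj => hint2 i hi j hj]
    rw [← nsmul_eq_mul]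
    refine Finset.sum_le_card_nsmul _ _ _ fun i hi => ?_
    rw [integral_finsetSum _ fun j hj => hint2 i hi j hj, Finset.sum_eq_single i]
    · have : ∫ ω, ξ i ω * ξ i ω ∂μ ≤ ∫ _ω, B ^ 2 ∂μ :=
        integral_mono (hint2 i hi i hi) (integrable_const _) fun ω => by
          have := hbdd i hi ω
          show ξ i ω * ξ i ω ≤ B ^ 2
          rw [← sq, ← sq_abs]
          gcongr
      simpa using this
    · intro j hj hji
      rcases lt_or_gt_of_ne hji with h | h
      · simpa only [mul_comm] using horth j hj i hi h
      · exact horth i hi j hj h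
    · exact fun h => absurd hi h
  have hintsq : Integrable (fun ω => (∑ n ∈ s, ξ n ω) ^ 2) μ := by
    simp only [hexp]
    exact integrable_finsetSum _ fun i hi => integrable_finsetSum _ fun j hj => hint2 i hi j hj
  have hmem : MemLp (fun ω => |∑ n ∈ s, ξ n ω|) 2 μ :=
    (memLp_two_iff_integrable_sq hsum.norm).2 (by simpa [sq_abs] using hintsq)
  -- Nonnegative variance passes from the second moment to the first.
  have hvar := ProbabilityTheory.variance_nonneg (fun ω => |∑ n ∈ s, ξ n ω|) μ
  rw [ProbabilityTheory.variance_eq_sub hmem] at hvar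
  have h1 : (∫ ω, |∑ n ∈ s, ξ n ω| ∂μ) ^ 2 ≤ s.card * B ^ 2 := by
    refine le_trans (sub_nonneg.1 hvar) (le_trans (le_of_eq ?_) hsq)
    simp [sq_abs]
  calc ∫ ω, |∑ n ∈ s, ξ n ω| ∂μ ≤ Real.sqrt (s.card * B ^ 2) := Real.le_sqrt_of_sq_le h1
    _ = B * Real.sqrt s.card := by
      rw [Real.sqrt_mul (Nat.cast_nonneg _), Real.sqrt_sq hB, mul_comm]

theorem HasCondPMF.aestronglyMeasurable {X : Ω → α} {p : Ω → α → ℝ} (hX : HasCondPMF μ m X p)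
    (a : α) : AEStronglyMeasurable[m] (fun ω => p ω a) μ :=
  stronglyMeasurable_condExp.aestronglyMeasurable.congr (hX a)

variable [Fintype α]

/-- The score `Y` of the outcome `X`, centered by its mean under the probabilities `p`. -/
def centered (X : Ω → α) (p Y : Ω → α → ℝ) (ω : Ω) : ℝ :=
  Y ω (X ω) - ∑ a, p ω a * Y ω a

theorem abs_centered_le {X : Ω → α} {p Y : Ω → α → ℝ} (hp : ∀ ω a, 0 ≤ p ω a)
    (hp1 : ∀ ω, ∑ a, p ω a = 1) (hY : ∀ ω a, |Y ω a| ≤ 1) (ω : Ω) :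
    |centered X p Y ω| ≤ 2 := by
  have h : |∑ a, p ω a * Y ω a| ≤ 1 := by
    refine (Finset.abs_sum_le_sum_abs _ _).trans ?_
    rw [← hp1 ω]
    refine Finset.sum_le_sum fun a _ => ?_
    rw [abs_mul, abs_of_nonneg (hp ω a)]
    exact mul_le_of_le_one_right (hp ω a) (hY ω a)
  calc _ ≤ |Y ω (X ω)| + |∑ a, p ω a * Y ω a| := abs_sub _ _
    _ ≤ 2 := by linarith [hY ω (X ω)]

theorem HasCondPMF.aestronglyMeasurable_centered {m' : MeasurableSpace Ω} (hm : m ≤ m')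
    {X : Ω → α} {p Y : Ω → α → ℝ} (hXm : DiscreteMeasurable m' X)
    (hX : HasCondPMF μ m X p) (hY : ∀ a, AEStronglyMeasurable[m] (fun ω => Y ω a) μ) :
    AEStronglyMeasurable[m'] (centered X p Y) μ := by
  refine AEStronglyMeasurable.sub ?_ ?_
  · exact hXm.aestronglyMeasurable_comp (F := fun a ω => Y ω a) fun a => (hY a).mono hm
  · exact aestronglyMeasurable_sum _ fun a _ =>
      ((hX.aestronglyMeasurable a).mono hm).mul ((hY a).mono hm)

/-- Martingale-difference property: decompose over the outcomes of `X` and pull the `m`-measurable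
factor `Z * Y` out of the conditional expectation of each indicator. -/
theorem HasCondPMF.integral_mul_centered [IsProbabilityMeasure μ] (hm : m ≤ mΩ) {X : Ω → α}
    {p Y : Ω → α → ℝ} {Z : Ω → ℝ} {B : ℝ}
    (hXm : DiscreteMeasurable mΩ X) (hX : HasCondPMF μ m X p) (hp : ∀ ω a, 0 ≤ p ω a)
    (hp1 : ∀ ω, ∑ a, p ω a = 1) (hY : ∀ a, AEStronglyMeasurable[m] (fun ω => Y ω a) μ)
    (hY1 : ∀ ω a, |Y ω a| ≤ 1) (hZ : AEStronglyMeasurable[m] Z μ) (hZ1 : ∀ ω, |Z ω| ≤ B) :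
    ∫ ω, Z ω * centered X p Y ω ∂μ = 0 := by
  classical
  have hpa : ∀ ω a, p ω a ≤ 1 := fun ω a => by
    rw [← hp1 ω]; exact Finset.single_le_sum (fun b _ => hp ω b) (Finset.mem_univ a)
  let I : α → Ω → ℝ := fun a => (X ⁻¹' {a}).indicator fun _ => 1
  have hI : ∀ a, Integrable (I a) μ := fun a => (integrable_const _).indicator (hXm a)
  have hpi : ∀ a, Integrable (fun ω => p ω a) μ := fun a =>
    Integrable.of_bound ((hX.aestronglyMeasurable a).mono hm) 1
      (Filter.Eventually.of_forall fun ω => by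
        rw [Real.norm_eq_abs, abs_of_nonneg (hp ω a)]; exact hpa ω a)
  have hZY : ∀ a, AEStronglyMeasurable[m] (fun ω => Z ω * Y ω a) μ := fun a => hZ.mul (hY a)
  have hZYb : ∀ a, ∀ᵐ ω ∂μ, ‖Z ω * Y ω a‖ ≤ B := fun a =>
    Filter.Eventually.of_forall fun ω => by
      rw [Real.norm_eq_abs, abs_mul]
      exact (mul_le_of_le_one_right (abs_nonneg _) (hY1 ω a)).trans (hZ1 ω)
  have i1 : ∀ a, Integrable (fun ω => Z ω * Y ω a * I a ω) μ := fun a =>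
    (hI a).bdd_mul ((hZY a).mono hm) (hZYb a)
  have i2 : ∀ a, Integrable (fun ω => Z ω * Y ω a * p ω a) μ := fun a =>
    (hpi a).bdd_mul ((hZY a).mono hm) (hZYb a)
  have heq : ∀ a, ∫ ω, Z ω * Y ω a * I a ω ∂μ = ∫ ω, Z ω * Y ω a * p ω a ∂μ := fun a => by
    rw [← integral_condExp hm]
    refine integral_congr_ae ?_
    have h1 := condExp_stronglyMeasurable_mul_of_bound₀ hm (hZY a) (hI a) B (hZYb a)
    filter_upwards [h1, hX a] with ω h1 h2
    refine h1.trans ?_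
    rw [Pi.mul_apply, h2]
  have hsplit : ∀ ω, Z ω * centered X p Y ω =
      ∑ a, (Z ω * Y ω a * I a ω - Z ω * Y ω a * p ω a) := fun ω => by
    rw [Finset.sum_sub_distrib, centered, mul_sub, Finset.mul_sum]
    congr 1
    · rw [Finset.sum_eq_single (X ω)]
      · simp [I]
      · intro a _ ha
        have : I a ω = 0 := Set.indicator_of_notMem (fun h => ha (by simpa using h.symm)) _
        rw [this, mul_zero]
      · simp
    · exact Finset.sum_congr rfl fun a _ => by ring
  simp only [hsplit]
  rw [integral_finsetSum _ fun a _ => by exact (i1 a).sub (i2 a)]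
  refine Finset.sum_eq_zero fun a _ => ?_
  rw [integral_sub (i1 a) (i2 a), heq, sub_self]

/-- Centered scores of choices that become known one step after their law. The four stages of a
round are numbered as in `Run.IsRun`. -/
theorem integral_abs_sum_centered_le [IsProbabilityMeasure μ] {ℱ : Filtration ℕ mΩ} (r : ℕ)
    (s : Finset ℕ) {X : ℕ → Ω → α} {p Y : ℕ → Ω → α → ℝ}
    (hXm : ∀ n ∈ s, DiscreteMeasurable (ℱ (4 * n + r + 1)) (X n))
    (hX : ∀ n ∈ s, HasCondPMF μ (ℱ (4 * n + r)) (X n) (p n))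
    (hp : ∀ n ∈ s, ∀ ω a, 0 ≤ p n ω a) (hp1 : ∀ n ∈ s, ∀ ω, ∑ a, p n ω a = 1)
    (hY : ∀ n ∈ s, ∀ a, AEStronglyMeasurable[ℱ (4 * n + r)] (fun ω => Y n ω a) μ)
    (hY1 : ∀ n ∈ s, ∀ ω a, |Y n ω a| ≤ 1) :
    Integrable (fun ω => |∑ n ∈ s, centered (X n) (p n) (Y n) ω|) μ ∧
      ∫ ω, |∑ n ∈ s, centered (X n) (p n) (Y n) ω| ∂μ ≤ 2 * Real.sqrt s.card := by
  have hmeas : ∀ n ∈ s, AEStronglyMeasurable[ℱ (4 * n + r + 1)]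
      (centered (X n) (p n) (Y n)) μ := fun n hn =>
    (hX n hn).aestronglyMeasurable_centered (ℱ.mono (Nat.le_succ _)) (hXm n hn) (hY n hn)
  have hb : ∀ n ∈ s, ∀ ω, |centered (X n) (p n) (Y n) ω| ≤ 2 := fun n hn =>
    abs_centered_le (hp n hn) (hp1 n hn) (hY1 n hn)
  constructor
  · exact (integrable_finsetSum _ fun n hn => Integrable.of_bound
      ((hmeas n hn).mono (ℱ.le _)) 2 (Filter.Eventually.of_forall (hb n hn))).abs
  · refine integral_abs_sum_le zero_le_two s (fun n hn => (hmeas n hn).mono (ℱ.le _)) hb ?_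
    intro i hi j hj hij
    -- For `i < j` the earlier term is known at stage `4 * i + r + 1`, which precedes stage `4 * j +
    -- r`.
    exact (hX j hj).integral_mul_centered (ℱ.le _) ((hXm j hj).mono (ℱ.le _)) (hp j hj) (hp1 j hj)
      (hY j hj) (hY1 j hj) ((hmeas i hi).mono (ℱ.mono (by omega))) (hb i hi)

end probability

/-! ### Coordinates of the score as centered choices. -/

section coordinates

variable {d : ℕ}

theorem norm_le_sum_abs (v : EuclideanSpace ℝ (Fin d)) : ‖v‖ ≤ ∑ j, |v j| := by
  have h := (EuclideanSpace.basisFun (Fin d) ℝ).sum_repr v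
  calc ‖v‖ = ‖∑ j, v j • EuclideanSpace.basisFun (Fin d) ℝ j‖ := by
        conv_lhs => rw [← h]
        simp
    _ ≤ ∑ j, ‖v j • EuclideanSpace.basisFun (Fin d) ℝ j‖ := norm_sum_le _ _
    _ = ∑ j, |v j| := by simp [norm_smul]

theorem abs_apply_le_one {v : EuclideanSpace ℝ (Fin d)} (hv : ‖v‖ ≤ 1) (j : Fin d) :
    |v j| ≤ 1 := by
  have := PiLp.norm_apply_le v j
  rw [Real.norm_eq_abs] at this
  exact this.trans hv

theorem inner_sq_eq_sum (v y : EuclideanSpace ℝ (Fin d)) :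
    (inner ℝ v y) ^ 2 = ∑ i, ∑ j, v i * v j * (y i * y j) := by
  have : inner ℝ v y = ∑ i, v i * y i := by
    simp [PiLp.inner_apply, mul_comm]
  rw [this, sq, Finset.sum_mul_sum]
  exact Finset.sum_congr rfl fun i _ => Finset.sum_congr rfl fun j _ => by ring

/-- The `j`-th feature coordinate of the chosen object, zero if nothing in `C` is chosen. -/
def chosenCoord {ι : Type} [DecidableEq ι] (x : ι → EuclideanSpace ℝ (Fin d)) (C : Finset ι)
    (j : Fin d) : Option ι → ℝ
  | none => 0
  | some i => if i ∈ C then x i j else 0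

theorem abs_chosenCoord_le {ι : Type} [DecidableEq ι] {x : ι → EuclideanSpace ℝ (Fin d)}
    {C : Finset ι} (hx : ∀ i, ‖x i‖ ≤ 1) (j : Fin d) (o : Option ι) :
    |chosenCoord x C j o| ≤ 1 := by
  cases o with
  | none => simp [chosenCoord]
  | some i =>
    simp only [chosenCoord]
    split_ifs
    · exact abs_apply_le_one (hx i) j
    · simp

theorem gradLL_apply {ι : Type} [DecidableEq ι] [Fintype ι] (x : ι → EuclideanSpace ℝ (Fin d))
    (C : Finset ι) (o : Option ι) (θ : EuclideanSpace ℝ (Fin d)) (j : Fin d) :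
    gradLL x C o θ j =
      chosenCoord x C j o - ∑ a, mnlProb x C θ a * chosenCoord x C j a := by
  have e1 : chosenCoord x C j o = ∑ i ∈ C, (if o = some i then (1 : ℝ) else 0) * x i j := by
    cases o with
    | none => simp [chosenCoord]
    | some k => simp [chosenCoord]
  have e2 : ∑ a, mnlProb x C θ a * chosenCoord x C j a =
      ∑ i ∈ C, mnlProb x C θ (some i) * x i j := by
    rw [Fintype.sum_option]
    simp only [chosenCoord, mul_zero, zero_add]
    rw [← Finset.sum_subset (Finset.subset_univ C) fun i _ hi => by simp [hi]]
    exact Finset.sum_congr rfl fun i hi => by rw [if_pos hi]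
  rw [e1, e2, ← Finset.sum_sub_distrib]
  simp only [gradLL, WithLp.ofLp_sum, Finset.sum_apply, WithLp.ofLp_smul, Pi.smul_apply,
    smul_eq_mul, sub_mul]

end coordinates

/-! ### Pathwise analysis of a run. -/

namespace Run

variable {Ω : Type*} {d N K q : ℕ} {R : Run Ω d N K q} {mΩ : MeasurableSpace Ω} {μ : Measure Ω}
  {ℱ : Filtration ℕ mΩ} {b κ₂ lam : ℝ} {T T₀ : ℕ}

/-- Regret of a single round. -/
def roundRegret (R : Run Ω d N K q) (t : ℕ) (ω : Ω) : ℝ :=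
  (R.candidates t ω).sup' (R.candidates_nonempty t ω) (R.trueRevenue t ω) -
    R.trueRevenue t ω (R.C t ω)

open Classical in
/-- The rounds up to `t` with a conversation. -/
def convRounds (R : Run Ω d N K q) (t : ℕ) : Finset ℕ :=
  (Finset.Icc 1 t).filter fun s => s ∈ R.conv

theorem mem_convRounds {s t : ℕ} : s ∈ R.convRounds t ↔ s ∈ Finset.Icc 1 t ∧ s ∈ R.conv := by
  simp [convRounds]

theorem mem_Icc_of_mem_convRounds {s t : ℕ} (ht : t ∈ Finset.Icc 1 T) (hs : s ∈ R.convRounds t) :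
    s ∈ Finset.Icc 1 T := by
  have := (mem_convRounds.1 hs).1
  simp only [Finset.mem_Icc] at *
  omega

theorem trueRevenue_eq (R : Run Ω d N K q) (t : ℕ) (ω : Ω) (S : Finset (Fin N)) :
    R.trueRevenue t ω S = revenue (R.r t ω) (fun a => inner ℝ (R.x t ω a) R.θstar) S := by
  rw [trueRevenue, revenue, Finset.sum_div]
  refine Finset.sum_congr rfl fun i hi => ?_
  simp only [mnlProb, hi, if_true, mul_div_assoc]

theorem score_eq (R : Run Ω d N K q) (t : ℕ) (ω : Ω) (θ : EuclideanSpace ℝ (Fin d)) :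
    R.score t ω θ = ∑ s ∈ Finset.Ico 1 t, gradLL (R.x s ω) (R.C s ω) (R.ans s ω) θ +
      ∑ s ∈ R.convRounds t, gradLL (R.xkey s ω) (R.keySet s ω) (R.keyAns s ω) θ := by
  rw [score]
  congr 1
  rw [convRounds, Finset.sum_filter]
  refine Finset.sum_congr rfl fun s _ => ?_
  split_ifs with h
  · rfl
  · simp [keySet, h]

theorem card_keySet_le (R : Run Ω d N K q) (t : ℕ) (ω : Ω) : (R.keySet t ω).card ≤ q := by
  rw [keySet]
  split_ifs
  · exact Finset.card_image_le.trans (by simp)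
  · simp

theorem draw_mem_keySet {t : ℕ} (ht : t ∈ R.conv) (j : Fin q) (ω : Ω) :
    R.draw t j ω ∈ R.keySet t ω := by
  rw [keySet, if_pos ht]
  exact Finset.mem_image_of_mem _ (Finset.mem_univ j)

/-- Information in direction `y` from the `j`-th key-terms of the conversations up to `t`. -/
def drawInfo (R : Run Ω d N K q) (j : Fin q) (t : ℕ) (ω : Ω) (y : EuclideanSpace ℝ (Fin d)) : ℝ :=
  ∑ s ∈ R.convRounds t, (inner ℝ (R.xkey s ω (R.draw s j ω)) y) ^ 2

theorem drawInfo_le_design (R : Run Ω d N K q) (j : Fin q) (t : ℕ) (ω : Ω)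
    (y : EuclideanSpace ℝ (Fin d)) :
    R.drawInfo j t ω y ≤ y.ofLp ⬝ᵥ ((R.design t ω).mulVec y.ofLp) := by
  have e : y.ofLp ⬝ᵥ ((R.design t ω).mulVec y.ofLp) =
      ∑ s ∈ Finset.Ico 1 t, ∑ i ∈ R.C s ω, (inner ℝ (R.x s ω i) y) ^ 2 +
        ∑ s ∈ Finset.Icc 1 t, ∑ k ∈ R.keySet s ω, (inner ℝ (R.xkey s ω k) y) ^ 2 := by
    simp only [design, Matrix.add_mulVec, Matrix.sum_mulVec, dotProduct_add, dotProduct_sum,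
      dotProduct_outer_mulVec]
  rw [e, drawInfo]
  have h1 : (0 : ℝ) ≤ ∑ s ∈ Finset.Ico 1 t, ∑ i ∈ R.C s ω, (inner ℝ (R.x s ω i) y) ^ 2 := by
    positivity
  have h2 : ∑ s ∈ R.convRounds t, (inner ℝ (R.xkey s ω (R.draw s j ω)) y) ^ 2 ≤
      ∑ s ∈ Finset.Icc 1 t, ∑ k ∈ R.keySet s ω, (inner ℝ (R.xkey s ω k) y) ^ 2 := by
    rw [convRounds, Finset.sum_filter]
    refine Finset.sum_le_sum fun s _ => ?_
    split_ifs with h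
    · exact Finset.single_le_sum (f := fun k => (inner ℝ (R.xkey s ω k) y) ^ 2)
        (fun k _ => sq_nonneg _) (draw_mem_keySet h j ω)
    · positivity
  linarith

namespace IsRun

theorem norm_xkey_le (h : R.IsRun μ ℱ b κ₂ lam T T₀) {t : ℕ} (ht : t ∈ Finset.Icc 1 T) (ω : Ω)
    (k : Fin K) : ‖R.xkey t ω k‖ ≤ 1 := by
  have hw := h.w_pos k
  rw [xkey, norm_smul, norm_inv, Real.norm_of_nonneg hw.le, inv_mul_le_iff₀ hw, mul_one]
  refine (norm_sum_le _ _).trans (Finset.sum_le_sum fun a _ => ?_)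
  rw [norm_smul, Real.norm_of_nonneg (h.w_nonneg a k)]
  exact mul_le_of_le_one_right (h.w_nonneg a k) (h.norm_x t ht ω a)

theorem lam_mul_norm_sq_le (h : R.IsRun μ ℱ b κ₂ lam T T₀) {t : ℕ} (ht : t ∈ Finset.Icc 1 T)
    (ω : Ω) (y : EuclideanSpace ℝ (Fin d)) :
    lam * ‖y‖ ^ 2 ≤ (d : ℝ)⁻¹ * ∑ i, (inner ℝ (R.xkey t ω (R.spanner t ω i)) y) ^ 2 := by
  have := (h.lambda_min t ht ω).dotProduct_mulVec_nonneg y.ofLp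
  simp only [star_trivial, Matrix.sub_mulVec, dotProduct_sub, Matrix.smul_mulVec, dotProduct_smul,
    Matrix.sum_mulVec, dotProduct_sum, dotProduct_outer_mulVec, Matrix.one_mulVec,
    dotProduct_self_eq, smul_eq_mul] at this
  linarith

/-- Trace comparison: summing the eigenvalue bound over the coordinate vectors gives `lam * d` on
one side and a mean of squared norms, each at most 1, on the other. -/
theorem lam_mul_dim_le (h : R.IsRun μ ℱ b κ₂ lam T T₀) (hd : 1 ≤ d) {t : ℕ}
    (ht : t ∈ Finset.Icc 1 T) (ω : Ω) : lam * d ≤ 1 := by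
  have hd0 : (0 : ℝ) < d := by exact_mod_cast hd
  have h1 : ∀ j : Fin d, lam ≤ (d : ℝ)⁻¹ * ∑ i, (R.xkey t ω (R.spanner t ω i) j) ^ 2 := fun j => by
    simpa [EuclideanSpace.inner_single_right] using
      h.lam_mul_norm_sq_le ht ω (EuclideanSpace.single j 1)
  have h2 : ∑ _j : Fin d, lam ≤
      ∑ j : Fin d, (d : ℝ)⁻¹ * ∑ i, (R.xkey t ω (R.spanner t ω i) j) ^ 2 :=
    Finset.sum_le_sum fun j _ => h1 j
  have h3 : ∑ j : Fin d, ∑ i, (R.xkey t ω (R.spanner t ω i) j) ^ 2 ≤ d := by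
    rw [Finset.sum_comm]
    calc ∑ i : Fin d, ∑ j : Fin d, (R.xkey t ω (R.spanner t ω i) j) ^ 2 ≤ ∑ _i : Fin d, (1 : ℝ) := by
          refine Finset.sum_le_sum fun i _ => ?_
          have := EuclideanSpace.real_norm_sq_eq (R.xkey t ω (R.spanner t ω i))
          rw [← this]
          exact pow_le_one₀ (norm_nonneg _) (h.norm_xkey_le ht ω _)
      _ = d := by simp
  rw [← Finset.mul_sum, Finset.sum_const, Finset.card_univ, Fintype.card_fin, nsmul_eq_mul] at h2
  calc lam * d = d * lam := mul_comm _ _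
    _ ≤ _ := h2
    _ ≤ (d : ℝ)⁻¹ * d := by gcongr
    _ = 1 := inv_mul_cancel₀ hd0.ne'

theorem kappa_mul_card_le (h : R.IsRun μ ℱ b κ₂ lam T T₀) {t : ℕ}
    (ht : t ∈ Finset.Icc 1 T) (ω : Ω) : κ₂ * q ≤ 1 := by
  obtain ⟨S, hS, hcard⟩ := Finset.exists_subset_card_eq (h.card_avail t ht ω)
  have hSc : S ∈ R.candidates t ω := by simp [candidates, hS, hcard]
  have h1 : ∀ i ∈ S, κ₂ ≤ mnlProb (R.x t ω) S R.θstar (some i) := fun i hi => by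
    refine (h.kappa t ht ω S hSc i hi R.θstar (by simp)).trans
      (mul_le_of_le_one_right (mnlProb_nonneg _ _ _ _) ?_)
    have := sum_mnlProb_some (R.x t ω) S R.θstar
    have h0 : 0 ≤ ∑ i ∈ S, mnlProb (R.x t ω) S R.θstar (some i) :=
      Finset.sum_nonneg fun i _ => mnlProb_nonneg _ _ _ _
    linarith
  have h2 := Finset.sum_le_sum h1
  rw [sum_mnlProb_some, Finset.sum_const, hcard, nsmul_eq_mul] at h2
  linarith [mnlProb_nonneg (R.x t ω) S R.θstar none]

theorem abs_roundRegret_le (h : R.IsRun μ ℱ b κ₂ lam T T₀) {t : ℕ} (ht : t ∈ Finset.Icc 1 T)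
    (ω : Ω) : |R.roundRegret t ω| ≤ 2 := by
  have hb : ∀ S, |R.trueRevenue t ω S| ≤ 1 := fun S => by
    rw [trueRevenue_eq]; exact abs_revenue_le (h.abs_r t ht ω) _ S
  obtain ⟨S, _, hS⟩ := Finset.exists_mem_eq_sup' (R.candidates_nonempty t ω) (R.trueRevenue t ω)
  rw [roundRegret, hS]
  have h1 := abs_le.1 (hb S)
  have h2 := abs_le.1 (hb (R.C t ω))
  rw [abs_le]
  constructor <;> linarith

theorem inner_score_antitone (t : ℕ) (ω : Ω) (θ v : EuclideanSpace ℝ (Fin d)) :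
    inner ℝ (R.score t ω (θ + v)) v ≤ inner ℝ (R.score t ω θ) v := by
  simp only [score_eq, inner_add_left, sum_inner]
  gcongr <;> exact inner_gradLL_antitone _ _ _ _ _

theorem inner_score_strong (h : R.IsRun μ ℱ b κ₂ lam T T₀) {t : ℕ} (ht : t ∈ Finset.Icc 1 T)
    (ω : Ω) (j : Fin q) {n : ℝ} (hn : (q : ℝ) ≤ n) {v : EuclideanSpace ℝ (Fin d)} (hv : ‖v‖ ≤ 1) :
    inner ℝ (R.score t ω (R.θstar + v)) v + curvature n * R.drawInfo j t ω v ≤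
      inner ℝ (R.score t ω R.θstar) v := by
  simp only [score_eq, inner_add_left, sum_inner, drawInfo]
  rw [add_assoc, Finset.mul_sum, ← Finset.sum_add_distrib]
  refine add_le_add (Finset.sum_le_sum fun s _ => inner_gradLL_antitone _ _ _ _ _)
    (Finset.sum_le_sum fun s hs => ?_)
  exact inner_gradLL_strong _ _ _
    (fun k _ => h.norm_xkey_le (mem_Icc_of_mem_convRounds ht hs) ω k) h.norm_θstar hv
    ((Nat.cast_le.2 (R.card_keySet_le s ω)).trans hn) (draw_mem_keySet (mem_convRounds.1 hs).2 j ω)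

theorem hasFDerivAt_score (t : ℕ) (ω : Ω) (θ : EuclideanSpace ℝ (Fin d)) :
    HasFDerivAt (fun θ => ∑ s ∈ Finset.Ico 1 t, logLik (R.x s ω) (R.C s ω) (R.ans s ω) θ +
      ∑ s ∈ R.convRounds t, logLik (R.xkey s ω) (R.keySet s ω) (R.keyAns s ω) θ)
      (innerSL ℝ (R.score t ω θ)) θ := by
  rw [score_eq, map_add, map_sum, map_sum]
  exact (HasFDerivAt.fun_sum fun s _ => hasFDerivAt_logLik _ _ _ _).add
    (HasFDerivAt.fun_sum fun s _ => hasFDerivAt_logLik _ _ _ _)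

/-- Once the design is coercive and the score at `θ_*` is small, the estimate is accurate and the
assortment nearly optimal. -/
theorem roundRegret_le_of_coercive (h : R.IsRun μ ℱ b κ₂ lam T T₀) (hκ : 0 < κ₂) {t : ℕ}
    (ht : t ∈ Finset.Icc 1 T) (hT : T₀ < t) (ω : Ω) (j : Fin q) {n m : ℝ} (hn : (q : ℝ) ≤ n)
    (hm : 0 < m) (hinfo : ∀ y, m * ‖y‖ ^ 2 ≤ R.drawInfo j t ω y)
    (hsmall : ‖R.score t ω R.θstar‖ < curvature n * m) :
    R.roundRegret t ω ≤
      8 * (‖R.score t ω R.θstar‖ / (curvature n * m) + alpha d b κ₂ t / Real.sqrt m) := by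
  have hc := curvature_pos ((Nat.cast_nonneg q).trans hn)
  have hcm : 0 < curvature n * m := mul_pos hc hm
  have hα : 0 ≤ alpha d b κ₂ t := by unfold alpha; positivity
  have hstrong : ∀ v : EuclideanSpace ℝ (Fin d), ‖v‖ ≤ 1 →
      inner ℝ (R.score t ω (R.θstar + v)) v + curvature n * m * ‖v‖ ^ 2 ≤
        inner ℝ (R.score t ω R.θstar) v := fun v hv => by
    refine le_trans ?_ (h.inner_score_strong ht ω j hn hv)
    rw [mul_assoc]
    gcongr
    exact hinfo v
  have hzero := h.mle t ht hT ω (exists_zero_of_strong (hasFDerivAt_score t ω) hstrong hsmall)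
  have hnear := norm_sub_le_of_zero hcm (inner_score_antitone t ω) hstrong hsmall hzero
  have hM : ∀ y : EuclideanSpace ℝ (Fin d),
      m * ‖y‖ ^ 2 ≤ y.ofLp ⬝ᵥ ((R.design t ω).mulVec y.ofLp) := fun y =>
    (hinfo y).trans (R.drawInfo_le_design j t ω y)
  have hopt := h.C_opt t ht hT ω (det_ne_zero_of_coercive hm hM)
  set ε := ‖R.score t ω R.θstar‖ / (curvature n * m) + alpha d b κ₂ t / Real.sqrt m with hε
  have hε0 : 0 ≤ ε := by positivity
  -- Estimation error and bonus are simply added. True and optimistic revenue are then compared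
  -- twice, for the best and for the chosen assortment, which gives 8 = 4 + 4.
  have hz : ∀ a, |inner ℝ (R.x t ω a) R.θstar - R.ucb b κ₂ t ω a| ≤ ε := fun a => by
    have hx := h.norm_x t ht ω a
    have e : inner ℝ (R.x t ω a) R.θstar - R.ucb b κ₂ t ω a =
        -(inner ℝ (R.x t ω a) (R.θhat t ω - R.θstar) +
          alpha d b κ₂ t * invNorm (R.design t ω) (R.x t ω a)) := by
      rw [ucb, inner_sub_right]; ring
    rw [e, abs_neg]
    refine (abs_add_le _ _).trans (add_le_add ?_ ?_)
    · exact ((abs_real_inner_le_norm _ _).trans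
        (mul_le_of_le_one_left (norm_nonneg _) hx)).trans hnear
    · rw [abs_of_nonneg (mul_nonneg hα (by unfold invNorm; positivity)), div_eq_mul_one_div]
      gcongr
      exact invNorm_le_of_coercive hm hM hx
  have hz' : ∀ a, |R.ucb b κ₂ t ω a - inner ℝ (R.x t ω a) R.θstar| ≤ ε := fun a => by
    rw [abs_sub_comm]; exact hz a
  obtain ⟨S, hS, hSeq⟩ :=
    Finset.exists_mem_eq_sup' (R.candidates_nonempty t ω) (R.trueRevenue t ω)
  rw [roundRegret, hSeq, trueRevenue_eq, trueRevenue_eq]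
  have h1 := revenue_le_add hε0 (h.abs_r t ht ω) hz S
  have h2 := revenue_le_add hε0 (h.abs_r t ht ω) hz' (R.C t ω)
  have h3 := hopt S hS
  linarith

end IsRun

/-! ### Noise terms and the pointwise regret bound. -/

/-- Law of a single drawn key-term: uniform on the spanner. -/
def drawProb (R : Run Ω d N K q) (t : ℕ) (ω : Ω) (k : Fin K) : ℝ :=
  ((Finset.univ.filter (fun i => R.spanner t ω i = k)).card : ℝ) / d

/-- Fluctuation of the `(i, l)` entry of the information from the drawn key-terms. -/
def drawNoise (R : Run Ω d N K q) (j : Fin q) (i l : Fin d) (t : ℕ) (ω : Ω) : ℝ :=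
  ∑ s ∈ R.convRounds t, centered (R.draw s j) (R.drawProb s)
    (fun ω k => R.xkey s ω k i * R.xkey s ω k l) ω

theorem sum_drawProb_mul (R : Run Ω d N K q) (t : ℕ) (ω : Ω) (f : Fin K → ℝ) :
    ∑ k, R.drawProb t ω k * f k = (d : ℝ)⁻¹ * ∑ i, f (R.spanner t ω i) := by
  have : ∀ k, R.drawProb t ω k * f k =
      (d : ℝ)⁻¹ * ∑ i, if R.spanner t ω i = k then f (R.spanner t ω i) else 0 := fun k => by
    rw [← Finset.sum_filter, Finset.sum_congr rfl
      (fun i hi => congrArg f (Finset.mem_filter.1 hi).2), Finset.sum_const, nsmul_eq_mul, drawProb]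
    ring
  simp only [this]
  rw [← Finset.mul_sum, Finset.sum_comm]
  simp

/-- Each conversation contributes its conditional mean, at least `lam * ‖y‖²`, plus a centered
quadratic form in `y`. Only the `j`-th draw is followed, so the joint law of the draws within a
round plays no role. -/
theorem IsRun.card_sub_noise_le_drawInfo (h : R.IsRun μ ℱ b κ₂ lam T T₀) {t : ℕ}
    (ht : t ∈ Finset.Icc 1 T) (ω : Ω) (j : Fin q) (y : EuclideanSpace ℝ (Fin d)) :
    (lam * (R.convRounds t).card - ∑ i, ∑ l, |R.drawNoise j i l t ω|) * ‖y‖ ^ 2 ≤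
      R.drawInfo j t ω y := by
  have hs : ∀ s ∈ R.convRounds t, lam * ‖y‖ ^ 2 + ∑ i, ∑ l, centered (R.draw s j) (R.drawProb s)
      (fun ω k => R.xkey s ω k i * R.xkey s ω k l) ω * (y i * y l) ≤
        (inner ℝ (R.xkey s ω (R.draw s j ω)) y) ^ 2 := fun s hs => by
    have h1 := h.lam_mul_norm_sq_le (mem_Icc_of_mem_convRounds ht hs) ω y
    have h2 := R.sum_drawProb_mul s ω fun k => (inner ℝ (R.xkey s ω k) y) ^ 2
    have h3 : ∑ i, ∑ l, centered (R.draw s j) (R.drawProb s)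
        (fun ω k => R.xkey s ω k i * R.xkey s ω k l) ω * (y i * y l) =
        (inner ℝ (R.xkey s ω (R.draw s j ω)) y) ^ 2 -
          ∑ k, R.drawProb s ω k * (inner ℝ (R.xkey s ω k) y) ^ 2 := by
      simp only [centered, inner_sq_eq_sum, sub_mul, Finset.sum_sub_distrib]
      congr 1
      simp only [Finset.mul_sum, Finset.sum_mul]
      rw [Finset.sum_comm (s := (Finset.univ : Finset (Fin K)))]
      refine Finset.sum_congr rfl fun i _ => ?_
      rw [Finset.sum_comm]
      exact Finset.sum_congr rfl fun k _ => Finset.sum_congr rfl fun l _ => by ring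
    rw [h3]
    linarith
  have hsum := Finset.sum_le_sum hs
  rw [Finset.sum_add_distrib, Finset.sum_const, nsmul_eq_mul] at hsum
  have e : ∑ s ∈ R.convRounds t, ∑ i, ∑ l, centered (R.draw s j) (R.drawProb s)
      (fun ω k => R.xkey s ω k i * R.xkey s ω k l) ω * (y i * y l) =
        ∑ i, ∑ l, R.drawNoise j i l t ω * (y i * y l) := by
    rw [Finset.sum_comm]
    refine Finset.sum_congr rfl fun i _ => ?_
    rw [Finset.sum_comm]
    refine Finset.sum_congr rfl fun l _ => ?_
    rw [drawNoise, Finset.sum_mul]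
  rw [e] at hsum
  have := (abs_le.1 (abs_quadratic_le (fun i l => R.drawNoise j i l t ω) y)).1
  refine le_trans ?_ hsum
  linarith

/-- Fluctuation of the `j`-th coordinate of the score due to the item choices. -/
def itemNoise (R : Run Ω d N K q) (j : Fin d) (t : ℕ) (ω : Ω) : ℝ :=
  ∑ s ∈ Finset.Ico 1 t, centered (R.ans s) (fun ω => mnlProb (R.x s ω) (R.C s ω) R.θstar)
    (fun ω => chosenCoord (R.x s ω) (R.C s ω) j) ω

/-- Fluctuation of the `j`-th coordinate of the score due to the key-term choices. -/
def keyNoise (R : Run Ω d N K q) (j : Fin d) (t : ℕ) (ω : Ω) : ℝ :=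
  ∑ s ∈ R.convRounds t, centered (R.keyAns s)
    (fun ω => mnlProb (R.xkey s ω) (R.keySet s ω) R.θstar)
    (fun ω => chosenCoord (R.xkey s ω) (R.keySet s ω) j) ω

theorem norm_score_le (R : Run Ω d N K q) (t : ℕ) (ω : Ω) :
    ‖R.score t ω R.θstar‖ ≤ ∑ j, (|R.itemNoise j t ω| + |R.keyNoise j t ω|) := by
  refine (norm_le_sum_abs _).trans (Finset.sum_le_sum fun j _ => ?_)
  have : R.score t ω R.θstar j = R.itemNoise j t ω + R.keyNoise j t ω := by
    simp only [score_eq, WithLp.ofLp_add, WithLp.ofLp_sum, Pi.add_apply, Finset.sum_apply,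
      gradLL_apply]
    rfl
  rw [this]
  exact abs_add_le _ _

theorem IsRun.roundRegret_le (h : R.IsRun μ ℱ b κ₂ lam T T₀) (hb : 0 < b) (hκ : 0 < κ₂)
    (hlam : 0 < lam) {t : ℕ} (ht : t ∈ Finset.Icc 1 T) (hT : T₀ < t) (hbt : 2 ≤ b * t) (ω : Ω)
    (j : Fin q) {n : ℝ} (hn : (q : ℝ) ≤ n) :
    R.roundRegret t ω ≤ 8 * (alpha d b κ₂ t / Real.sqrt (lam * b / 4 * t)) +
      10 / (curvature n * (lam * b / 4) * t) * ∑ l, (|R.itemNoise l t ω| + |R.keyNoise l t ω|) +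
      2 / (lam * b / 4 * t) * ∑ i, ∑ l, |R.drawNoise j i l t ω| := by
  have hc := curvature_pos ((Nat.cast_nonneg q).trans hn)
  have ht0 : (0 : ℝ) < t := by
    have := (Finset.mem_Icc.1 ht).1
    exact_mod_cast this
  have hα : 0 ≤ alpha d b κ₂ t := by unfold alpha; positivity
  set m := lam * b / 4 * t with hm
  have hm0 : 0 < m := by positivity
  have hreg := (abs_le.1 (h.abs_roundRegret_le ht ω)).2
  have hS := R.norm_score_le t ω
  set S := ∑ l, (|R.itemNoise l t ω| + |R.keyNoise l t ω|)
  set D := ∑ i, ∑ l, |R.drawNoise j i l t ω|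
  have hS0 : 0 ≤ S := (norm_nonneg _).trans hS
  have hD0 : 0 ≤ D := by positivity
  have e : curvature n * (lam * b / 4) * t = curvature n * m := by rw [hm]; ring
  rw [e]
  have t1 : 0 ≤ 8 * (alpha d b κ₂ t / Real.sqrt m) := by positivity
  have t2 : 0 ≤ 10 / (curvature n * m) * S := by positivity
  have t3 : 0 ≤ 2 / m * D := by positivity
  -- In each bad case the corresponding noise term alone is at least 2, which the regret never
  -- exceeds.
  rcases le_or_gt D m with hD | hD
  swap
  · have : 2 ≤ 2 / m * D := by
      rw [div_mul_eq_mul_div, le_div_iff₀ hm0]; linarith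
    linarith
  rcases lt_or_ge ‖R.score t ω R.θstar‖ (curvature n * m) with hs | hs
  swap
  · have : 2 ≤ 10 / (curvature n * m) * S := by
      rw [div_mul_eq_mul_div, le_div_iff₀ (by positivity)]; linarith [mul_pos hc hm0]
    linarith
  -- The floor loses at most 1, which is at most half of `b * t ≥ 2`. The mean information is thus
  -- at least `2 * m`, and the noise `D ≤ m` leaves `m`.
  have hcard : b * t / 2 ≤ (R.convRounds t).card := by
    have h1 := h.conv_freq t ht
    have h2 := Nat.lt_floor_add_one (b * t)
    have h3 : ((⌊b * t⌋₊ : ℕ) : ℝ) ≤ (R.convRounds t).card := by exact_mod_cast h1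
    linarith
  have hinfo : ∀ y, m * ‖y‖ ^ 2 ≤ R.drawInfo j t ω y := fun y => by
    refine le_trans ?_ (h.card_sub_noise_le_drawInfo ht ω j y)
    gcongr
    have : lam * (b * t / 2) ≤ lam * (R.convRounds t).card := by gcongr
    have : lam * (b * t / 2) = 2 * m := by rw [hm]; ring
    linarith
  have hmain := h.roundRegret_le_of_coercive hκ ht hT ω j hn hm0 hinfo hs
  have : ‖R.score t ω R.θstar‖ / (curvature n * m) ≤ S / (curvature n * m) := by gcongr
  have e2 : 10 / (curvature n * m) * S = 10 * (S / (curvature n * m)) := by ring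
  have : 0 ≤ S / (curvature n * m) := by positivity
  linarith

end Run

/-! ### Expected noise and expected regret of one round. -/

namespace Run

variable {Ω : Type*} {d N K q : ℕ} {R : Run Ω d N K q} {mΩ : MeasurableSpace Ω} {μ : Measure Ω}
  {ℱ : Filtration ℕ mΩ} {b κ₂ lam : ℝ} {T T₀ : ℕ}

theorem card_convRounds_le (R : Run Ω d N K q) (t : ℕ) : (R.convRounds t).card ≤ t := by
  classical
  exact (Finset.card_filter_le _ _).trans (by simp)

namespace IsRun

theorem measurable_x_apply (h : R.IsRun μ ℱ b κ₂ lam T T₀) {t : ℕ} (ht : t ∈ Finset.Icc 1 T)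
    (a : Fin N) (j : Fin d) : Measurable[ℱ (4 * t)] fun ω => R.x t ω a j :=
  (EuclideanSpace.proj (𝕜 := ℝ) j).continuous.measurable.comp (h.x_meas t ht a)

theorem measurable_xkey_apply (h : R.IsRun μ ℱ b κ₂ lam T T₀) {t : ℕ} (ht : t ∈ Finset.Icc 1 T)
    (k : Fin K) (j : Fin d) : Measurable[ℱ (4 * t)] fun ω => R.xkey t ω k j := by
  have e : (fun ω => R.xkey t ω k j) =
      fun ω => (∑ a, R.w a k)⁻¹ * ∑ a, R.w a k * R.x t ω a j := by
    funext ω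
    simp [xkey]
  rw [e]
  exact (Finset.measurable_fun_sum _ fun a _ => (h.measurable_x_apply ht a j).const_mul _).const_mul _

theorem drawNoise_bound [IsProbabilityMeasure μ] (h : R.IsRun μ ℱ b κ₂ lam T T₀) (hd : 1 ≤ d)
    {t : ℕ} (ht : t ∈ Finset.Icc 1 T) (j : Fin q) (i l : Fin d) :
    Integrable (fun ω => |R.drawNoise j i l t ω|) μ ∧
      ∫ ω, |R.drawNoise j i l t ω| ∂μ ≤ 2 * Real.sqrt t := by
  have hd0 : (d : ℝ) ≠ 0 := by positivity
  have hmem : ∀ s ∈ R.convRounds t, s ∈ Finset.Icc 1 T := fun s hs => mem_Icc_of_mem_convRounds ht hs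
  have := integral_abs_sum_centered_le (μ := μ) (ℱ := ℱ) 0 (R.convRounds t)
    (X := fun s => R.draw s j) (p := R.drawProb) (Y := fun s ω k => R.xkey s ω k i * R.xkey s ω k l)
    (fun s hs => h.draw_meas s (hmem s hs) (mem_convRounds.1 hs).2 j)
    (fun s hs => h.draw_law s (hmem s hs) (mem_convRounds.1 hs).2 j)
    (fun s _ ω k => by unfold drawProb; positivity)
    (fun s _ ω => by
      have := R.sum_drawProb_mul s ω fun _ => 1
      simpa [hd0] using this)
    (fun s hs k => ((h.measurable_xkey_apply (hmem s hs) k i).mul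
      (h.measurable_xkey_apply (hmem s hs) k l)).stronglyMeasurable.aestronglyMeasurable)
    (fun s hs ω k => by
      have hx := h.norm_xkey_le (hmem s hs) ω k
      rw [abs_mul]
      exact mul_le_one₀ (abs_apply_le_one hx i) (abs_nonneg _) (abs_apply_le_one hx l))
  refine ⟨this.1, this.2.trans ?_⟩
  gcongr
  exact R.card_convRounds_le t

theorem keyNoise_bound [IsProbabilityMeasure μ] (h : R.IsRun μ ℱ b κ₂ lam T T₀)
    {t : ℕ} (ht : t ∈ Finset.Icc 1 T) (j : Fin d) :
    Integrable (fun ω => |R.keyNoise j t ω|) μ ∧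
      ∫ ω, |R.keyNoise j t ω| ∂μ ≤ 2 * Real.sqrt t := by
  have hmem : ∀ s ∈ R.convRounds t, s ∈ Finset.Icc 1 T := fun s hs => mem_Icc_of_mem_convRounds ht hs
  have := integral_abs_sum_centered_le (μ := μ) (ℱ := ℱ) 1 (R.convRounds t)
    (X := R.keyAns) (p := fun s ω => mnlProb (R.xkey s ω) (R.keySet s ω) R.θstar)
    (Y := fun s ω => chosenCoord (R.xkey s ω) (R.keySet s ω) j)
    (fun s hs => h.keyAns_meas s (hmem s hs) (mem_convRounds.1 hs).2)
    (fun s hs => h.keyAns_law s (hmem s hs) (mem_convRounds.1 hs).2)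
    (fun s _ ω k => mnlProb_nonneg _ _ _ _)
    (fun s _ ω => sum_mnlProb _ _ _)
    (fun s hs o => by
      cases o with
      | none => exact aestronglyMeasurable_const
      | some k =>
        classical
        -- The offered key set is a function of the joint draw, which has finitely many values.
        have hX : DiscreteMeasurable (ℱ (4 * s + 1)) fun ω j => R.draw s j ω := fun f => by
          have e : (fun ω j => R.draw s j ω) ⁻¹' {f} = ⋂ j, R.draw s j ⁻¹' {f j} := by
            ext ω; simp [funext_iff]
          rw [e]
          exact MeasurableSet.iInter fun j =>
            h.draw_meas s (hmem s hs) (mem_convRounds.1 hs).2 j (f j)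
        have := hX.aestronglyMeasurable_comp (μ := μ)
          (F := fun f ω => if k ∈ Finset.univ.image f then R.xkey s ω k j else 0) fun f => by
            split_ifs
            · exact ((h.measurable_xkey_apply (hmem s hs) k j).mono
                (ℱ.mono (Nat.le_succ _)) le_rfl).stronglyMeasurable.aestronglyMeasurable
            · exact aestronglyMeasurable_const
        refine this.congr (Filter.Eventually.of_forall fun ω => ?_)
        simp [chosenCoord, keySet, (mem_convRounds.1 hs).2])
    (fun s hs ω o => abs_chosenCoord_le (h.norm_xkey_le (hmem s hs) ω) j o)
  refine ⟨this.1, this.2.trans ?_⟩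
  gcongr
  exact R.card_convRounds_le t

theorem itemNoise_bound [IsProbabilityMeasure μ] (h : R.IsRun μ ℱ b κ₂ lam T T₀)
    {t : ℕ} (ht : t ∈ Finset.Icc 1 T) (j : Fin d) :
    Integrable (fun ω => |R.itemNoise j t ω|) μ ∧
      ∫ ω, |R.itemNoise j t ω| ∂μ ≤ 2 * Real.sqrt t := by
  have hmem : ∀ s ∈ Finset.Ico 1 t, s ∈ Finset.Icc 1 T := fun s hs => by
    simp only [Finset.mem_Icc, Finset.mem_Ico] at *; omega
  have := integral_abs_sum_centered_le (μ := μ) (ℱ := ℱ) 3 (Finset.Ico 1 t)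
    (X := R.ans) (p := fun s ω => mnlProb (R.x s ω) (R.C s ω) R.θstar)
    (Y := fun s ω => chosenCoord (R.x s ω) (R.C s ω) j)
    (fun s hs => h.ans_meas s (hmem s hs))
    (fun s hs => h.ans_law s (hmem s hs))
    (fun s _ ω k => mnlProb_nonneg _ _ _ _)
    (fun s _ ω => sum_mnlProb _ _ _)
    (fun s hs o => by
      cases o with
      | none => exact aestronglyMeasurable_const
      | some a =>
        exact (h.C_meas s (hmem s hs)).aestronglyMeasurable_comp (μ := μ)
          (F := fun S ω => if a ∈ S then R.x s ω a j else 0) fun S => by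
            split_ifs
            · exact ((h.measurable_x_apply (hmem s hs) a j).mono
                (ℱ.mono (Nat.le_add_right _ _)) le_rfl).stronglyMeasurable.aestronglyMeasurable
            · exact aestronglyMeasurable_const)
    (fun s hs ω o => abs_chosenCoord_le (h.norm_x s (hmem s hs) ω) j o)
  refine ⟨this.1, this.2.trans ?_⟩
  gcongr
  simp

theorem aestronglyMeasurable_roundRegret (h : R.IsRun μ ℱ b κ₂ lam T T₀) {t : ℕ}
    (ht : t ∈ Finset.Icc 1 T) : AEStronglyMeasurable (R.roundRegret t) μ := by
  have hrev : ∀ S, Measurable fun ω => R.trueRevenue t ω S := fun S => by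
    have hr : ∀ a, Measurable fun ω => R.r t ω a := fun a => (h.r_meas t ht a).mono (ℱ.le _) le_rfl
    have hx : ∀ a, Measurable fun ω => R.x t ω a := fun a => (h.x_meas t ht a).mono (ℱ.le _) le_rfl
    simp only [trueRevenue_eq, revenue]
    fun_prop
  refine AEStronglyMeasurable.sub ?_ ?_
  · have hne : ∀ A : Finset (Fin N), (A.powerset.filter fun S => S.card ≤ q).Nonempty := fun A =>
      ⟨∅, by simp⟩
    have hsup : ∀ A : Finset (Fin N), AEStronglyMeasurable
        (fun ω => (A.powerset.filter fun S => S.card ≤ q).sup' (hne A) (R.trueRevenue t ω)) μ := by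
      intro A
      have := Finset.measurable_sup' (f := fun S ω => R.trueRevenue t ω S) (hne A) fun S _ => hrev S
      exact this.aestronglyMeasurable.congr
        (Filter.Eventually.of_forall fun ω => Finset.sup'_apply _ _ _)
    exact ((h.avail_meas t ht).mono (ℱ.le _)).aestronglyMeasurable_comp hsup
  · exact ((h.C_meas t ht).mono (ℱ.le _)).aestronglyMeasurable_comp
      (F := fun S ω => R.trueRevenue t ω S) fun S => (hrev S).aestronglyMeasurable

theorem integrable_roundRegret [IsProbabilityMeasure μ] (h : R.IsRun μ ℱ b κ₂ lam T T₀) {t : ℕ}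
    (ht : t ∈ Finset.Icc 1 T) : Integrable (R.roundRegret t) μ :=
  Integrable.of_bound (h.aestronglyMeasurable_roundRegret ht) 2
    (Filter.Eventually.of_forall (h.abs_roundRegret_le ht))

theorem integral_roundRegret_le_two [IsProbabilityMeasure μ] (h : R.IsRun μ ℱ b κ₂ lam T T₀)
    {t : ℕ} (ht : t ∈ Finset.Icc 1 T) : ∫ ω, R.roundRegret t ω ∂μ ≤ 2 := by
  have := integral_mono (h.integrable_roundRegret ht) (integrable_const (2 : ℝ))
    fun ω => (abs_le.1 (h.abs_roundRegret_le ht ω)).2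
  simpa using this

theorem integral_roundRegret_le [IsProbabilityMeasure μ] (h : R.IsRun μ ℱ b κ₂ lam T T₀)
    (hd : 1 ≤ d) (hb : 0 < b) (hκ : 0 < κ₂) (hlam : 0 < lam) {t : ℕ} (ht : t ∈ Finset.Icc 1 T)
    (hT : T₀ < t) (hbt : 2 ≤ b * t) (j : Fin q) {n : ℝ} (hn : (q : ℝ) ≤ n) :
    ∫ ω, R.roundRegret t ω ∂μ ≤ 8 * (alpha d b κ₂ t / Real.sqrt (lam * b / 4 * t)) +
      10 / (curvature n * (lam * b / 4) * t) * (d * (4 * Real.sqrt t)) +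
      2 / (lam * b / 4 * t) * (d * (d * (2 * Real.sqrt t))) := by
  have hc := curvature_pos ((Nat.cast_nonneg q).trans hn)
  have iS : ∀ l, Integrable (fun ω => |R.itemNoise l t ω| + |R.keyNoise l t ω|) μ := fun l =>
    (h.itemNoise_bound ht l).1.add (h.keyNoise_bound ht l).1
  have iD : ∀ i, Integrable (fun ω => ∑ l, |R.drawNoise j i l t ω|) μ := fun i =>
    integrable_finsetSum _ fun l _ => (h.drawNoise_bound hd ht j i l).1
  have iSS := integrable_finsetSum Finset.univ fun l _ => iS l
  have iDD := integrable_finsetSum Finset.univ fun i _ => iD i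
  have hS : ∫ ω, ∑ l, (|R.itemNoise l t ω| + |R.keyNoise l t ω|) ∂μ ≤ d * (4 * Real.sqrt t) := by
    rw [integral_finsetSum _ fun l _ => iS l]
    calc _ ≤ ∑ _l : Fin d, 4 * Real.sqrt t := Finset.sum_le_sum fun l _ => by
          rw [integral_add (h.itemNoise_bound ht l).1 (h.keyNoise_bound ht l).1]
          linarith [(h.itemNoise_bound ht l).2, (h.keyNoise_bound ht l).2]
      _ = d * (4 * Real.sqrt t) := by simp
  have hD : ∫ ω, ∑ i, ∑ l, |R.drawNoise j i l t ω| ∂μ ≤ d * (d * (2 * Real.sqrt t)) := by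
    rw [integral_finsetSum _ fun i _ => iD i]
    calc _ ≤ ∑ _i : Fin d, ∑ _l : Fin d, 2 * Real.sqrt t := Finset.sum_le_sum fun i _ => by
          rw [integral_finsetSum _ fun l _ => (h.drawNoise_bound hd ht j i l).1]
          exact Finset.sum_le_sum fun l _ => (h.drawNoise_bound hd ht j i l).2
      _ = d * (d * (2 * Real.sqrt t)) := by simp
  have hmono := integral_mono (h.integrable_roundRegret ht)
    (((integrable_const (8 * (alpha d b κ₂ t / Real.sqrt (lam * b / 4 * t)))).add
      (iSS.const_mul (10 / (curvature n * (lam * b / 4) * t)))).add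
        (iDD.const_mul (2 / (lam * b / 4 * t))))
    fun ω => h.roundRegret_le hb hκ hlam ht hT hbt ω j hn
  refine hmono.trans ?_
  rw [integral_add' ((integrable_const _).add (iSS.const_mul _)) (iDD.const_mul _),
    integral_add' (integrable_const _) (iSS.const_mul _)]
  simp only [integral_const, probReal_univ, one_smul, integral_const_mul]
  gcongr

end IsRun

end Run

/-! ### Growth estimates and uniform constants. -/

theorem sum_inv_sqrt_le (T : ℕ) : ∑ t ∈ Finset.Icc 1 T, 1 / Real.sqrt t ≤ 2 * Real.sqrt T := by
  induction T with
  | zero => simp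
  | succ n ih =>
    rw [Finset.sum_Icc_succ_top (by omega)]
    have h0 : 0 < Real.sqrt ((n + 1 : ℕ) : ℝ) := Real.sqrt_pos.2 (by positivity)
    have h1 := Real.sq_sqrt (Nat.cast_nonneg (α := ℝ) (n + 1))
    have h2 := Real.sq_sqrt (Nat.cast_nonneg (α := ℝ) n)
    have h3 := Real.sqrt_nonneg (n : ℝ)
    have : 1 / Real.sqrt ((n + 1 : ℕ) : ℝ) ≤
        2 * Real.sqrt ((n + 1 : ℕ) : ℝ) - 2 * Real.sqrt n := by
      rw [div_le_iff₀ h0]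
      push_cast at *
      nlinarith [sq_nonneg (Real.sqrt ((n : ℝ) + 1) - Real.sqrt n)]
    linarith

theorem half_le_log {T : ℕ} (hT : 2 ≤ T) : 1 / 2 ≤ Real.log T := by
  have h1 : Real.log 2 ≤ Real.log T := Real.log_le_log (by norm_num) (by exact_mod_cast hT)
  linarith [Real.log_two_gt_d9]

theorem half_le_sqrt_log {T : ℕ} (hT : 2 ≤ T) : 1 / 2 ≤ Real.sqrt (Real.log T) := by
  refine Real.le_sqrt_of_sq_le ?_
  linarith [half_le_log hT]

theorem alpha_le {d t T : ℕ} {b κ₂ D : ℝ} (hd : 1 ≤ d) (hdD : (d : ℝ) ≤ D) (hb : 0 < b)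
    (hb1 : b < 1) (hκ : 0 < κ₂) (ht : 1 ≤ t) (htT : t ≤ T) (hT : 2 ≤ T) :
    alpha d b κ₂ t ≤ 1 / (2 * κ₂) * Real.sqrt (6 * D + 2) * Real.sqrt (Real.log T) := by
  have hd1 : (1 : ℝ) ≤ d := by exact_mod_cast hd
  have ht1 : (1 : ℝ) ≤ t := by exact_mod_cast ht
  have htT' : (t : ℝ) ≤ T := by exact_mod_cast htT
  have hT2 : (2 : ℝ) ≤ T := by exact_mod_cast hT
  have hlogT := half_le_log hT
  rw [alpha, mul_assoc (1 / (2 * κ₂)), ← Real.sqrt_mul (by linarith)]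
  gcongr
  have h1 : (b * t + t) / d ≤ 2 * T := by
    rw [div_le_iff₀ (by linarith)]
    nlinarith
  have h2 : Real.log (1 + (b * t + t) / d) ≤ 3 * Real.log T := by
    have : Real.log (1 + (b * t + t) / d) ≤ Real.log ((T : ℝ) ^ 3) := by
      apply Real.log_le_log (by positivity)
      -- The argument of the logarithm is at most `1 + 2 * T ≤ 4 * T`; the cubic bound uses `T ≥ 2`.
      have : (4 : ℝ) * T ≤ T ^ 3 := by nlinarith [mul_self_nonneg ((T : ℝ) - 2)]
      linarith
    rw [Real.log_pow] at this
    exact_mod_cast this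
  have h3 : Real.log t ≤ Real.log T := Real.log_le_log (by linarith) htT'
  calc 2 * d * Real.log (1 + (b * t + t) / d) + 2 * Real.log t
      ≤ 2 * d * (3 * Real.log T) + 2 * Real.log T := by gcongr
    _ ≤ 2 * D * (3 * Real.log T) + 2 * Real.log T := by gcongr
    _ = (6 * D + 2) * Real.log T := by ring

/-- With `d ≤ 1 / lam` and `q ≤ 1 / κ₂`, the lower bound on `δ` makes `log (1 / δ)` at most `2 log
T` plus a constant; constants are absorbed through `log T ≥ 1 / 2`. -/
theorem explorationOrder_le {b κ₂ lam δ₀ : ℝ} (hb : 0 < b) (hb1 : b < 1) (hκ : 0 < κ₂)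
    (hlam : 0 < lam) (hδ₀ : 0 < δ₀) :
    ∃ A : ℝ, 0 < A ∧ ∀ (d q T : ℕ) (δ : ℝ), 1 ≤ d → 1 ≤ q → 2 ≤ T → δ₀ / (T : ℝ) ^ 2 ≤ δ →
      lam * d ≤ 1 → κ₂ * q ≤ 1 → explorationOrder d q T b κ₂ lam δ ≤ A * Real.log T := by
  set L := |Real.log (128 / (δ₀ * lam ^ 3))| with hL
  have hL0 : 0 ≤ L := abs_nonneg _
  refine ⟨1 / κ₂ ^ 2 * (2 / lam + 4) + 8 / κ₂ + 256 / (b * lam) * (2 * L + 2), by positivity,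
    fun d q T δ hd hq hT hδ hlamd hκq => ?_⟩
  have hd1 : (1 : ℝ) ≤ d := by exact_mod_cast hd
  have hq1 : (1 : ℝ) ≤ q := by exact_mod_cast hq
  have hT2 : (2 : ℝ) ≤ T := by exact_mod_cast hT
  have hlogT := half_le_log hT
  have hdD : (d : ℝ) ≤ 1 / lam := by rw [le_div_iff₀ hlam]; linarith
  have hqQ : (q : ℝ) ≤ 1 / κ₂ := by rw [le_div_iff₀ hκ]; linarith
  have hδ0 : 0 < δ := lt_of_lt_of_le (by positivity) hδ
  have p1 : 0 ≤ 1 / κ₂ ^ 2 * (2 / lam + 4) * Real.log T := by positivity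
  have p2 : 0 ≤ 8 / κ₂ * Real.log T := by positivity
  have p3 : 0 ≤ 256 / (b * lam) * (2 * L + 2) * Real.log T := by positivity
  have b1 : 1 / κ₂ ^ 2 * (d * Real.log ((b * T + T) / d) + 4 * Real.log T) ≤
      1 / κ₂ ^ 2 * (2 / lam + 4) * Real.log T := by
    have h1 : Real.log ((b * T + T) / d) ≤ 2 * Real.log T := by
      have : Real.log ((b * T + T) / d) ≤ Real.log ((T : ℝ) ^ 2) := by
        apply Real.log_le_log (by positivity)
        rw [div_le_iff₀ (by linarith)]
        nlinarith
      rw [Real.log_pow] at this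
      exact_mod_cast this
    rw [mul_assoc]
    gcongr
    calc d * Real.log ((b * T + T) / d) + 4 * Real.log T
        ≤ d * (2 * Real.log T) + 4 * Real.log T := by gcongr
      _ ≤ 1 / lam * (2 * Real.log T) + 4 * Real.log T := by gcongr
      _ = (2 / lam + 4) * Real.log T := by ring
  have b2 : (q : ℝ) / (1 / 2 : ℝ) ^ 2 ≤ 8 / κ₂ * Real.log T := by
    calc (q : ℝ) / (1 / 2 : ℝ) ^ 2 = 4 * q := by ring
      _ ≤ 4 * (1 / κ₂) := by gcongr
      _ = 8 / κ₂ * (1 / 2) := by ring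
      _ ≤ 8 / κ₂ * Real.log T := by gcongr
  have b3 : 256 / (b * q * lam) * Real.log (128 * d / (δ * lam ^ 2)) ≤
      256 / (b * lam) * (2 * L + 2) * Real.log T := by
    have h1 : 128 * d / (δ * lam ^ 2) ≤ 128 / (δ₀ * lam ^ 3) * (T : ℝ) ^ 2 := by
      calc 128 * d / (δ * lam ^ 2) ≤ 128 * (1 / lam) / (δ₀ / (T : ℝ) ^ 2 * lam ^ 2) := by gcongr
        _ = 128 / (δ₀ * lam ^ 3) * (T : ℝ) ^ 2 := by field_simp
    have h2 : Real.log (128 * d / (δ * lam ^ 2)) ≤ (2 * L + 2) * Real.log T := by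
      have h3 := Real.log_le_log (by positivity) h1
      rw [Real.log_mul (by positivity) (by positivity), Real.log_pow] at h3
      have h4 : Real.log (128 / (δ₀ * lam ^ 3)) ≤ L := le_abs_self _
      push_cast at h3
      nlinarith
    calc 256 / (b * q * lam) * Real.log (128 * d / (δ * lam ^ 2))
        ≤ 256 / (b * q * lam) * ((2 * L + 2) * Real.log T) := by gcongr
      _ ≤ 256 / (b * 1 * lam) * ((2 * L + 2) * Real.log T) := by gcongr
      _ = 256 / (b * lam) * (2 * L + 2) * Real.log T := by ring
  rw [explorationOrder, add_mul, add_mul]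
  refine max_le (by linarith) (max_le (by linarith) (by linarith))

theorem exists_integral_roundRegret_le {b κ₂ lam : ℝ} (hb : 0 < b) (hb1 : b < 1) (hκ : 0 < κ₂)
    (hlam : 0 < lam) :
    ∃ A : ℝ, 0 < A ∧ ∀ (d N K q T T₀ : ℕ), 1 ≤ d → 1 ≤ q → 2 ≤ T → lam * d ≤ 1 → κ₂ * q ≤ 1 →
      ∀ (Ω : Type*) (mΩ : MeasurableSpace Ω) (μ : Measure Ω) (_ : IsProbabilityMeasure μ)
        (ℱ : Filtration ℕ mΩ) (R : Run Ω d N K q), R.IsRun μ ℱ b κ₂ lam T T₀ →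
          ∀ t ∈ Finset.Icc 1 T, T₀ < t →
            ∫ ω, R.roundRegret t ω ∂μ ≤ A * Real.sqrt (Real.log T) * (1 / Real.sqrt t) := by
  set m := lam * b / 4 with hm
  have hm0 : 0 < m := by positivity
  have hc : 0 < curvature (1 / κ₂) := curvature_pos (by positivity)
  set κ := curvature (1 / κ₂)
  set a₁ := 8 * (1 / (2 * κ₂) * Real.sqrt (6 * (1 / lam) + 2)) / Real.sqrt m with ha₁
  refine ⟨a₁ + 80 / (κ * m) * (1 / lam) + 8 / m * (1 / lam) ^ 2 + 4 * Real.sqrt (2 / b),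
    by positivity, fun d N K q T T₀ hd hq hT hlamd hκq Ω mΩ μ _ ℱ R h t ht htT => ?_⟩
  have ht' := Finset.mem_Icc.1 ht
  have ht0 : (0 : ℝ) < t := by exact_mod_cast ht'.1
  have hst : 0 < Real.sqrt t := Real.sqrt_pos.2 ht0
  have hdD : (d : ℝ) ≤ 1 / lam := by rw [le_div_iff₀ hlam]; linarith
  have hqQ : (q : ℝ) ≤ 1 / κ₂ := by rw [le_div_iff₀ hκ]; linarith
  have hℓ := half_le_sqrt_log hT
  set ℓ := Real.sqrt (Real.log T)
  have ha₁0 : 0 ≤ a₁ := by positivity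
  have p1 : 0 ≤ a₁ * ℓ * (1 / Real.sqrt t) := by positivity
  have p2 : 0 ≤ 80 / (κ * m) * (1 / lam) * ℓ * (1 / Real.sqrt t) := by positivity
  have p3 : 0 ≤ 8 / m * (1 / lam) ^ 2 * ℓ * (1 / Real.sqrt t) := by positivity
  have p4 : 0 ≤ 4 * Real.sqrt (2 / b) * ℓ * (1 / Real.sqrt t) := by positivity
  simp only [add_mul]
  rcases le_or_gt 2 (b * t) with hbt | hbt
  swap
  -- Early rounds, `t < 2 / b`: here 1/√t is bounded below, so the trivial bound 2 already has the
  -- required form.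
  · have h2 := h.integral_roundRegret_le_two ht
    have : 2 ≤ 4 * Real.sqrt (2 / b) * ℓ * (1 / Real.sqrt t) := by
      rw [mul_one_div, le_div_iff₀ hst]
      have : Real.sqrt t ≤ Real.sqrt (2 / b) :=
        Real.sqrt_le_sqrt (by rw [le_div_iff₀ hb]; linarith)
      nlinarith [Real.sqrt_nonneg (2 / b)]
    linarith
  -- Draw number 0 is followed, and the curvature is taken at `1 / κ₂ ≥ q` so that it does not
  -- depend on `q`.
  have hmain := h.integral_roundRegret_le hd hb hκ hlam ht htT hbt ⟨0, hq⟩ hqQ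
  have hα := alpha_le hd hdD hb hb1 hκ ht'.1 ht'.2 hT
  have hinv : Real.sqrt t / t = 1 / Real.sqrt t := by
    rw [div_eq_div_iff ht0.ne' hst.ne', one_mul, Real.mul_self_sqrt ht0.le]
  have e1 : 8 * (alpha d b κ₂ t / Real.sqrt (m * t)) ≤ a₁ * ℓ * (1 / Real.sqrt t) := by
    rw [Real.sqrt_mul hm0.le]
    calc 8 * (alpha d b κ₂ t / (Real.sqrt m * Real.sqrt t))
        ≤ 8 * (1 / (2 * κ₂) * Real.sqrt (6 * (1 / lam) + 2) * ℓ / (Real.sqrt m * Real.sqrt t)) := by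
          gcongr
      _ = a₁ * ℓ * (1 / Real.sqrt t) := by rw [ha₁]; field_simp
  have e2 : 10 / (κ * m * t) * (d * (4 * Real.sqrt t)) ≤
      80 / (κ * m) * (1 / lam) * ℓ * (1 / Real.sqrt t) := by
    calc 10 / (κ * m * t) * (d * (4 * Real.sqrt t)) =
          80 / (κ * m) * d * (1 / 2) * (Real.sqrt t / t) := by field_simp; norm_num
      _ ≤ 80 / (κ * m) * (1 / lam) * ℓ * (Real.sqrt t / t) := by gcongr
      _ = _ := by rw [hinv]
  have e3 : 2 / (m * t) * (d * (d * (2 * Real.sqrt t))) ≤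
      8 / m * (1 / lam) ^ 2 * ℓ * (1 / Real.sqrt t) := by
    calc 2 / (m * t) * (d * (d * (2 * Real.sqrt t))) =
          8 / m * (d : ℝ) ^ 2 * (1 / 2) * (Real.sqrt t / t) := by field_simp; norm_num
      _ ≤ 8 / m * (1 / lam) ^ 2 * ℓ * (Real.sqrt t / t) := by gcongr
      _ = _ := by rw [hinv]
  linarith

end

end ConMNL

/-! ### Summation over all rounds. -/

theorem theorem2 (b κ₂ lam c δ₀ : ℝ) (hb : 0 < b) (hb1 : b < 1) (hκ : 0 < κ₂) (hlam : 0 < lam)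
    (hc : 0 < c) (hδ₀ : 0 < δ₀) :
    ∃ A : ℝ, 0 < A ∧
      ∀ (d N K q T T₀ : ℕ) (δ : ℝ), 1 ≤ d → 2 ≤ q → 2 ≤ T →
        δ₀ / (T : ℝ) ^ 2 ≤ δ → δ ≤ 1 / 8 →
        (T₀ : ℝ) ≤ c * ConMNL.explorationOrder d q T b κ₂ lam δ →
        ∀ (Ω : Type*) (mΩ : MeasurableSpace Ω) (μ : MeasureTheory.Measure Ω)
          (_ : MeasureTheory.IsProbabilityMeasure μ) (ℱ : MeasureTheory.Filtration ℕ mΩ)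
          (R : ConMNL.Run Ω d N K q),
          R.IsRun μ ℱ b κ₂ lam T T₀ →
            MeasureTheory.Integrable (R.regret T) μ ∧
              ∫ ω, R.regret T ω ∂μ ≤ A * Real.sqrt (d * T * q * Real.log T) := by
  obtain ⟨A₁, hA₁, hround⟩ := ConMNL.exists_integral_roundRegret_le hb hb1 hκ hlam
  obtain ⟨A₂, hA₂, horder⟩ := ConMNL.explorationOrder_le hb hb1 hκ hlam hδ₀
  refine ⟨2 * (c * A₂) + 2 * A₁, by positivity,
    fun d N K q T T₀ δ hd hq hT hδ _ hT₀ Ω mΩ μ hμ ℱ R h => ?_⟩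
  have h1 : (1 : ℕ) ∈ Finset.Icc 1 T := Finset.mem_Icc.2 ⟨le_rfl, by omega⟩
  -- The bounds on `d` and `q` are deterministic but are read off at a sample point in round 1.
  obtain ⟨ω₀⟩ : Nonempty Ω := nonempty_of_isProbabilityMeasure μ
  have hlamd := h.lam_mul_dim_le hd h1 ω₀
  have hκq := h.kappa_mul_card_le h1 ω₀
  have hint : ∀ t ∈ Finset.Icc 1 T, Integrable (R.roundRegret t) μ := fun t ht =>
    h.integrable_roundRegret ht
  have hregret : R.regret T = fun ω => ∑ t ∈ Finset.Icc 1 T, R.roundRegret t ω := rfl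
  rw [hregret]
  refine ⟨integrable_finsetSum _ hint, ?_⟩
  rw [integral_finsetSum _ hint]
  set ℓ := Real.sqrt (Real.log T) with hℓ
  have hlog : 0 ≤ Real.log T := by linarith [ConMNL.half_le_log hT]
  have hbound : ∀ t ∈ Finset.Icc 1 T, ∫ ω, R.roundRegret t ω ∂μ ≤
      (if t ∈ Finset.Icc 1 T₀ then 2 else 0) + A₁ * ℓ * (1 / Real.sqrt t) := fun t ht => by
    have ht' := Finset.mem_Icc.1 ht
    split_ifs with hmem
    · have : 0 ≤ A₁ * ℓ * (1 / Real.sqrt t) := by positivity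
      linarith [h.integral_roundRegret_le_two ht]
    · rw [zero_add]
      refine hround d N K q T T₀ hd (by omega) hT hlamd hκq Ω mΩ μ hμ ℱ R h t ht ?_
      simp only [Finset.mem_Icc] at hmem
      omega
  have hexpl : ∑ t ∈ Finset.Icc 1 T, (if t ∈ Finset.Icc 1 T₀ then (2 : ℝ) else 0) ≤ 2 * T₀ := by
    rw [← Finset.sum_filter, Finset.sum_const, nsmul_eq_mul, mul_comm]
    have : ((Finset.Icc 1 T).filter fun t => t ∈ Finset.Icc 1 T₀).card ≤ T₀ :=
      (Finset.card_le_card fun t ht => (Finset.mem_filter.1 ht).2).trans (by simp)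
    gcongr
  -- Turns the logarithmic exploration cost into a multiple of √(T log T).
  have hℓT : ℓ ≤ Real.sqrt T := Real.sqrt_le_sqrt (Real.log_le_self (Nat.cast_nonneg T))
  have hT₀' : (T₀ : ℝ) ≤ c * A₂ * (ℓ * Real.sqrt T) := by
    calc (T₀ : ℝ) ≤ c * (A₂ * Real.log T) := hT₀.trans (by
          gcongr
          exact horder d q T δ hd (by omega) hT hδ hlamd hκq)
      _ = c * A₂ * (ℓ * ℓ) := by rw [Real.mul_self_sqrt hlog]; ring
      _ ≤ c * A₂ * (ℓ * Real.sqrt T) := by gcongr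
  have hfinal : ℓ * Real.sqrt T ≤ Real.sqrt (d * T * q * Real.log T) := by
    rw [hℓ, ← Real.sqrt_mul hlog]
    refine Real.sqrt_le_sqrt ?_
    have hd1 : (1 : ℝ) ≤ d := by exact_mod_cast hd
    have hq1 : (1 : ℝ) ≤ q := by exact_mod_cast (by omega : 1 ≤ q)
    have : (1 : ℝ) ≤ d * q := one_le_mul_of_one_le_of_one_le hd1 hq1
    calc Real.log T * T = 1 * (Real.log T * T) := (one_mul _).symm
      _ ≤ d * q * (Real.log T * T) := by gcongr
      _ = d * T * q * Real.log T := by ring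
  calc ∑ t ∈ Finset.Icc 1 T, ∫ ω, R.roundRegret t ω ∂μ
      ≤ ∑ t ∈ Finset.Icc 1 T,
        ((if t ∈ Finset.Icc 1 T₀ then 2 else 0) + A₁ * ℓ * (1 / Real.sqrt t)) :=
        Finset.sum_le_sum hbound
    _ = ∑ t ∈ Finset.Icc 1 T, (if t ∈ Finset.Icc 1 T₀ then (2 : ℝ) else 0) +
        A₁ * ℓ * ∑ t ∈ Finset.Icc 1 T, 1 / Real.sqrt t := by
        rw [Finset.sum_add_distrib, ← Finset.mul_sum]
    _ ≤ 2 * (c * A₂ * (ℓ * Real.sqrt T)) + A₁ * ℓ * (2 * Real.sqrt T) := by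
        refine add_le_add (hexpl.trans (by linarith)) ?_
        gcongr
        exact ConMNL.sum_inv_sqrt_le T
    _ = (2 * (c * A₂) + 2 * A₁) * (ℓ * Real.sqrt T) := by ring
    _ ≤ _ := by gcongr
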